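/- Let $M$ be a smooth (Hausdorff) manifold without boundary of dimension $n$, and let $X:\mathbb R\times M\to TM$, $X_t:=X(t,\cdot)$, be a smooth time-dependent vector field. Assume that $X$ is complete, i.e. for every $(t_0,q_0)\in\mathbb R\times M$ the Cauchy problem $\dot\gamma(t)=X(t,\gamma(t))$, $\gamma(t_0)=q_0$, has a solution $\gamma(\,\cdot\,;t_0,q_0)$ defined on all of $\mathbb R$, and let $\varphi^{t_1,t_0}(q):=\gamma(t_1;t_0,q)$ be its time-dependent flow. A density on $M$ assigns to each $q\in M$ a function $\mu_q:(T_qM)^n\to\mathbb R$ with $\mu_q(Tv_1,\dots,Tv_n)=|\det T|\,\mu_q(v_1,\dots,v_n)$ for all linear $T:T_qM\to T_qM$; it is positive if $\mu_q(v_1,\dots,v_n)>0$ for linearly independent $v_1,\dots,v_n$, and smooth if in every smooth chart it equals $f\,|dx_1\wedge\dots\wedge dx_n|$ with $f$ smooth. The pullback along $F:M\to M$ is $(F^*\mu)_p(v_1,\dots,v_n)=\mu_{F(p)}(dF_pv_1,\dots,dF_pv_n)$. For a smooth vector field $Y$ with local flow $\theta_t$, put $\mathcal L_Y\mu=\frac{d}{dt}\big|_{t=0}\theta_t^*\mu$;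 for a smooth positive density $\mu$ the divergence $\operatorname{div}_\mu Y$ is the function with $\mathcal L_Y\mu=\operatorname{div}_\mu(Y)\,\mu$. Let $\mu$ be a smooth positive density on $M$ and let $\rho_0\in C^\infty(M)$. Then for every $t\in\mathbb R$ there is a unique function $\rho_t:M\to\mathbb R$ with $$\rho_t\,\mu=(\varphi^{0,t})^*(\rho_0\,\mu),$$ the function $\rho(q,t):=\rho_t(q)$ is smooth on $M\times\mathbb R$, and it satisfies the continuity equation $$X_t(\rho_t)+\rho_t\,\operatorname{div}_\mu(X_t)=-\partial_t\rho\qquad\text{on } M\times\mathbb R .$$ -/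

import Mathlib

open scoped Manifold ContDiff Topology

noncomputable section

/-- A density on an `n`-dimensional real vector space `V`: a function `μ` of `n` vectors with
`μ (T v₁, …, T vₙ) = |det T| * μ (v₁, …, vₙ)` for every linear map `T : V → V`. -/
@[ext]
structure VectorDensity (n : ℕ) (V : Type*) [AddCommGroup V] [Module ℝ V] where
  toFun : (Fin n → V) → ℝ
  map_comp' : ∀ (T : V →ₗ[ℝ] V) (v : Fin n → V),
    toFun (fun i => T (v i)) = |LinearMap.det T| * toFun v

namespace VectorDensity

variable {n : ℕ} {V W : Type*} [AddCommGroup V] [Module ℝ V] [AddCommGroup W] [Module ℝ W]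

instance : CoeFun (VectorDensity n V) (fun _ => (Fin n → V) → ℝ) := ⟨toFun⟩

instance : SMul ℝ (VectorDensity n V) where
  smul c μ :=
    { toFun := fun v => c * μ v
      map_comp' := fun T v => by rw [μ.map_comp']; ring }

@[simp] theorem smul_apply (c : ℝ) (μ : VectorDensity n V) (v : Fin n → V) :
    (c • μ) v = c * μ v := rfl

/-- A density is positive if it is positive on all linearly independent tuples. -/
def IsPositive (μ : VectorDensity n V) : Prop :=
  ∀ v : Fin n → V, LinearIndependent ℝ v → 0 < μ v

/-- The pullback of a density along a linear map between spaces of the same finite dimension: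
`(A^* μ) (v₁, …, vₙ) = μ (A v₁, …, A vₙ)`. -/
def pullback [FiniteDimensional ℝ V] [FiniteDimensional ℝ W]
    (h : Module.finrank ℝ V = Module.finrank ℝ W) (A : V →ₗ[ℝ] W) (μ : VectorDensity n W) :
    VectorDensity n V where
  toFun v := μ (fun i => A (v i))
  map_comp' T v := by
    have L : V ≃ₗ[ℝ] W := LinearEquiv.ofFinrankEq V W h
    have key : ∀ (S : V →ₗ[ℝ] V) (u : Fin n → V),
        μ (fun i => L (S (u i))) = |LinearMap.det S| * μ (fun i => L (u i)) := by
      intro S u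
      have := μ.map_comp' ((L : V →ₗ[ℝ] W) ∘ₗ S ∘ₗ (L.symm : W →ₗ[ℝ] V)) (fun i => L (u i))
      rw [LinearMap.det_conj] at this
      simpa using this
    have h1 := key ((L.symm : W →ₗ[ℝ] V) ∘ₗ A ∘ₗ T) v
    have h2 := key ((L.symm : W →ₗ[ℝ] V) ∘ₗ A) v
    have h3 : LinearMap.det ((L.symm : W →ₗ[ℝ] V) ∘ₗ A ∘ₗ T)
        = LinearMap.det ((L.symm : W →ₗ[ℝ] V) ∘ₗ A) * LinearMap.det T := by
      rw [← LinearMap.comp_assoc, LinearMap.det_comp]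
    rw [h3, abs_mul] at h1
    simp only [LinearMap.coe_comp, LinearEquiv.coe_coe, Function.comp_apply,
      LinearEquiv.apply_symm_apply] at h1 h2
    rw [h1, h2]
    ring

/-- Densities on `V` are proportional: `ν = (ν b / μ b) • μ` for a basis `b` with `μ b ≠ 0`. -/
theorem eq_ratio_smul (b : Module.Basis (Fin n) ℝ V) (μ ν : VectorDensity n V)
    (hμ : μ b ≠ 0) : ν = (ν b / μ b) • μ := by
  ext v
  have hv : v = fun i => (b.constr ℝ v) (b i) := by
    funext i; simp
  have h1 := ν.map_comp' (b.constr ℝ v) b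
  have h2 := μ.map_comp' (b.constr ℝ v) b
  rw [← hv] at h1 h2
  change ν v = ν b / μ b * μ v
  rw [h1, h2]
  field_simp

end VectorDensity

section Manifold

variable {n : ℕ} {M : Type*} [TopologicalSpace M] [ChartedSpace (EuclideanSpace ℝ (Fin n)) M]

instance (q : M) : FiniteDimensional ℝ (TangentSpace (𝓡 n) q) :=
  inferInstanceAs (FiniteDimensional ℝ (EuclideanSpace ℝ (Fin n)))

variable (n M) in
/-- A density on the `n`-manifold `M`: a section of the density bundle of `M`
(no regularity assumed). -/
def Density : Type _ := ∀ q : M, VectorDensity n (TangentSpace (𝓡 n) q)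

namespace Density

/-- The density `f μ`, for a function `f` on `M`. -/
instance : SMul (M → ℝ) (Density n M) := ⟨fun f μ q => f q • μ q⟩

def IsPositive (μ : Density n M) : Prop := ∀ q, (μ q).IsPositive

/-- A density is smooth if in every smooth chart `e = (x₁, …, xₙ)` of `M` it has the form
`f |dx₁ ∧ ⋯ ∧ dxₙ|` with `f` smooth. Here `f` is written as a function of the
coordinates, so that `f x` is the value of `μ` at `e⁻¹ x` on the coordinate vectors
`∂₁, …, ∂ₙ`, where `∂ᵢ = d(e⁻¹)ₓ (eᵢ)`. -/
def IsSmooth (μ : Density n M) : Prop :=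
  ∀ e ∈ IsManifold.maximalAtlas (𝓡 n) ∞ M,
    ContDiffOn ℝ ∞ (fun x : EuclideanSpace ℝ (Fin n) => μ (e.symm x) (fun i =>
      mfderiv (𝓡 n) (𝓡 n) e.symm x (EuclideanSpace.single i (1 : ℝ)))) e.target

/-- The pullback density: `(F^* μ)_p (v₁, …, vₙ) = μ_{F p} (dF_p v₁, …, dF_p vₙ)`. -/
def pullback (F : M → M) (μ : Density n M) : Density n M := fun p =>
  VectorDensity.pullback rfl (mfderiv (𝓡 n) (𝓡 n) F p).toLinearMap (μ (F p))

/-- The standard basis of `T_q M`, the coordinate basis of the preferred chart at `q`. -/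
def stdBasis (q : M) : Module.Basis (Fin n) ℝ (TangentSpace (𝓡 n) q) :=
  (EuclideanSpace.basisFun (Fin n) ℝ).toBasis

/-- The function `f` with `f μ = ν`, for a positive density `μ`. -/
def ratio (ν μ : Density n M) : M → ℝ := fun q => ν q (stdBasis q) / μ q (stdBasis q)

theorem ratio_smul {μ : Density n M} (hμ : μ.IsPositive) (ν : Density n M) :
    ν.ratio μ • μ = ν := by
  funext q
  exact ((VectorDensity.eq_ratio_smul (stdBasis q) (μ q) (ν q)
    (hμ q _ (stdBasis q).linearIndependent).ne')).symm

theorem smul_left_injective {μ : Density n M} (hμ : μ.IsPositive) {f g : M → ℝ}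
    (h : f • μ = g • μ) : f = g := by
  funext q
  have h1 := congrArg (fun ν : Density n M => ν q (stdBasis q)) h
  exact mul_right_cancel₀ (hμ q _ (stdBasis q).linearIndependent).ne' h1

end Density

/-- `θ` restricts to a local flow of the vector field `X` near `q`: for some `ε > 0` and all `p`
near `q`, the curve `t ↦ θ t p`, `|t| < ε`, is an integral curve of `X` starting at `p`. -/
def IsLocalFlowAt (X : ∀ p : M, TangentSpace (𝓡 n) p) (q : M) (θ : ℝ → M → M) : Prop :=
  ∃ ε > (0 : ℝ), ∀ᶠ p in 𝓝 q,
    θ 0 p = p ∧ IsMIntegralCurveOn (I := 𝓡 n) (fun t => θ t p) X (Set.Ioo (-ε) ε)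

open Classical in
/-- A local flow of `X` near `q` (it exists, and is unique near `(0, q)`, if `X` is smooth and `M`
is Hausdorff). -/
def localFlow (X : ∀ p : M, TangentSpace (𝓡 n) p) (q : M) : ℝ → M → M :=
  if h : ∃ θ, IsLocalFlowAt X q θ then h.choose else fun _ p => p

/-- The Lie derivative of a density along a vector field:
`(L_X μ)_q = d/dt|_{t=0} (θ_t^* μ)_q`, where `θ` is the local flow of `X` near `q`. -/
def lieDerivative (X : ∀ p : M, TangentSpace (𝓡 n) p) (μ : Density n M) : Density n M :=
  fun q =>
    { toFun := fun v => deriv (fun t : ℝ => μ.pullback (localFlow X q t) q v) 0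
      map_comp' := fun T v => by
        simp only [(Density.pullback _ μ q).map_comp' T v]
        exact deriv_const_mul_field _ }

/-- The divergence of `X` with respect to a positive density `μ`: the function with
`L_X μ = div_μ X • μ`. -/
def divergence (μ : Density n M) (X : ∀ p : M, TangentSpace (𝓡 n) p) : M → ℝ :=
  (lieDerivative X μ).ratio μ

theorem divergence_smul {μ : Density n M} (hμ : μ.IsPositive)
    (X : ∀ p : M, TangentSpace (𝓡 n) p) :
    divergence μ X • μ = lieDerivative X μ :=
  Density.ratio_smul hμ _

/-- The derivative `v(f) = df_q(v)` of a function `f` along a tangent vector `v` at `q`. -/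
def tangentDeriv {q : M} (v : TangentSpace (𝓡 n) q) (f : M → ℝ) : ℝ :=
  mfderiv (𝓡 n) 𝓘(ℝ, ℝ) f q v

/-- Smoothness of a time-dependent vector field, as a map `ℝ × M → TM`. -/
def IsSmoothTimeDependent [IsManifold (𝓡 n) ∞ M]
    (X : ℝ → ∀ p : M, TangentSpace (𝓡 n) p) : Prop :=
  ContMDiff (𝓘(ℝ, ℝ).prod (𝓡 n)) (𝓡 n).tangent ∞
    (fun p : ℝ × M => (⟨p.2, X p.1 p.2⟩ : TangentBundle (𝓡 n) M))

/-- `γ : ℝ → M` solves `γ' t = X t (γ t)` for all times `t`. -/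
def IsTimeDependentIntegralCurve (X : ℝ → ∀ p : M, TangentSpace (𝓡 n) p) (γ : ℝ → M) : Prop :=
  ∀ t : ℝ, HasMFDerivAt 𝓘(ℝ, ℝ) (𝓡 n) γ t
    ((ContinuousLinearMap.id ℝ ℝ).smulRight (X t (γ t)))

/-- Completeness: for all `(t₀, q₀)` the Cauchy problem `γ' t = X t (γ t)`, `γ t₀ = q₀` has a
solution defined on all of `ℝ` (which is then its maximal solution). -/
def IsCompleteTimeDependent (X : ℝ → ∀ p : M, TangentSpace (𝓡 n) p) : Prop :=
  ∀ (t₀ : ℝ) (q₀ : M), ∃ γ : ℝ → M, IsTimeDependentIntegralCurve X γ ∧ γ t₀ = q₀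

/-- The time-dependent flow: `timeDependentFlow hX t₁ t₀ q` is the value at time `t₁` of the solution
with value `q` at time `t₀` (unique if `X` is smooth and `M` is Hausdorff). -/
def timeDependentFlow {X : ℝ → ∀ p : M, TangentSpace (𝓡 n) p} (hX : IsCompleteTimeDependent X)
    (t₁ t₀ : ℝ) (q : M) : M :=
  (hX t₀ q).choose t₁

theorem timeDependentFlow_isIntegralCurve {X : ℝ → ∀ p : M, TangentSpace (𝓡 n) p}
    (hX : IsCompleteTimeDependent X) (t₀ : ℝ) (q : M) :
    IsTimeDependentIntegralCurve X (fun t => timeDependentFlow hX t t₀ q) :=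
  (hX t₀ q).choose_spec.1

theorem timeDependentFlow_self {X : ℝ → ∀ p : M, TangentSpace (𝓡 n) p}
    (hX : IsCompleteTimeDependent X) (t₀ : ℝ) (q : M) :
    timeDependentFlow hX t₀ t₀ q = q :=
  (hX t₀ q).choose_spec.2

end Manifold

end

/-!
The statement rests on two facts: the time-dependent flow `φ^{t₁,t₀}` is jointly smooth in times
and point, and the pullbacks of a smooth density along a family of maps have a derivative in the
parameter that depends only on the velocity of the family.

*Smooth dependence of flows.* For a `Cⁿ` vector field `g` on a Banach space, the solutions on
`[-1, 1]` of `u' = a g(u)`, `u 0 = x`, are the zeros of `rescaledODE : u - x - a ∫₀ g(u)`, a `Cⁿ`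
map in `(a, x)` and `u ∈ C([-1, 1], E)`, because post-composition with `g` is a `Cⁿ` map of the
space of continuous functions (`ContinuousMap.contDiff_comp_left`). At `a = 0` its derivative in
`u` is the identity, so the implicit function theorem gives a solution that is `Cⁿ` in `(a, x)`;
its value at time `1` is the flow at time `a` (`ContDiff.exists_contDiffAt_localFlow`). Reading a
vector field on a manifold in a chart gives `ContMDiff.exists_contMDiffAt_localFlow`, and the
group law together with the connectedness of `ℝ` spreads regularity from time `0` to all times
(`ContMDiff.contMDiff_flow`). The time-dependent case is the autonomous one for the field `(1, X)`
on `ℝ × M` (`contMDiff_timeDependentFlow`).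

*Densities.* In charts the pullback of `f |dx₁ ∧ ⋯ ∧ dxₙ|` along a map with coordinate
representation `G` is `|det DG| (f ∘ G) |dx₁ ∧ ⋯ ∧ dxₙ|` (`Density.coord_pullback`). Hence `ρ` is
a quotient of smooth functions; the absolute value is harmless as the flow consists of
diffeomorphisms. If `Θ s` is a family of maps with `Θ s₀ = id` and velocity `v` at `s₀`, then
`D(Θ s)` has derivative `Dv` at `s₀` by the symmetry of second derivatives, so that the derivative at
`s₀` of the pullbacks of `μ` depends on `v` only (`Density.IsSmooth.hasDerivAt_coord_pullback`).
Both `s ↦ φ^{s,t}` at `s = t` and the local flow of `X_t` at time `0` have velocity `X_t`;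
therefore `d/ds (φ^{s,t})^* μ = div_μ(X_t) μ` at `s = t`.

*The continuity equation.* By the cocycle property of the flow, `(φ^{s,t})^* (ρ_s μ) = ρ_t μ` for
all `s`. Differentiating this at `s = t` with the product rule, the factor `ρ_s ∘ φ^{s,t}`
contributes `∂_t ρ + X_t(ρ_t)` and the factor `(φ^{s,t})^* μ` contributes `div_μ(X_t) μ`.
-/

noncomputable section

open Set Filter

/-! ### Post-composition on spaces of continuous functions -/

namespace ContinuousMap

universe u

variable {K : Type*} [TopologicalSpace K] [CompactSpace K]
  {E F : Type*} [NormedAddCommGroup E] [NormedSpace ℝ E] [NormedAddCommGroup F] [NormedSpace ℝ F]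

variable (K E F) in
/-- Pointwise application `(A, u) ↦ (x ↦ A x (u x))` as a bounded bilinear map on spaces of
continuous functions on a compact space. -/
def pointwiseApplyL : C(K, E →L[ℝ] F) →L[ℝ] C(K, E) →L[ℝ] C(K, F) :=
  LinearMap.mkContinuous₂
    (LinearMap.mk₂ ℝ (fun (A : C(K, E →L[ℝ] F)) (u : C(K, E)) =>
        (⟨fun x => A x (u x), by fun_prop⟩ : C(K, F)))
      (fun A B u => by ext; simp) (fun c A u => by ext; simp)
      (fun A u v => by ext; simp) (fun c A u => by ext; simp))
    1 (fun A u => by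
      rw [ContinuousMap.norm_le _ (by positivity)]
      intro x
      rw [one_mul]
      exact ((A x).le_opNorm (u x)).trans
        (mul_le_mul (A.norm_coe_le_norm x) (u.norm_coe_le_norm x) (norm_nonneg _) (norm_nonneg A)))

/-- Post-composition with a `C¹` map `f` is differentiable on `C(K, E)`, its derivative at `u` being
pointwise multiplication by `Df ∘ u`. -/
theorem hasFDerivAt_comp_left {f : E → F} (hf : ContDiff ℝ 1 f) (u : C(K, E)) :
    HasFDerivAt (fun v : C(K, E) => (⟨f, hf.continuous⟩ : C(E, F)).comp v)
      (pointwiseApplyL K E F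
        ((⟨fderiv ℝ f, hf.continuous_fderiv one_ne_zero⟩ : C(E, E →L[ℝ] F)).comp u)) u := by
  set D : C(E, E →L[ℝ] F) := ⟨fderiv ℝ f, hf.continuous_fderiv one_ne_zero⟩
  refine HasFDerivAt.of_isLittleO (Asymptotics.isLittleO_iff.2 fun c hc => ?_)
  obtain ⟨δ, hδ, hD⟩ := (Metric.continuousAt_iff (α := C(K, E)) (β := C(K, E →L[ℝ] F))).1
    (D.continuous_postcomp.continuousAt (x := u)) c hc
  filter_upwards [Metric.ball_mem_nhds u hδ] with v hv
  -- Pointwise mean value inequality on `[u x, v x]`: `Df` is within `c` of `Df (u x)` there, since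
  -- the functions on the segment from `u` to `v` stay in the ball where `D ∘ ·` varies by
  -- at most `c`.
  rw [ContinuousMap.norm_le _ (by positivity)]
  intro x
  have key := (convex_segment (u x) (v x)).norm_image_sub_le_of_norm_fderiv_le' (𝕜 := ℝ)
    (f := f) (φ := fderiv ℝ f (u x)) (C := c)
    (fun y _ => (hf.differentiable one_ne_zero) y) ?_
    (left_mem_segment ℝ _ _) (right_mem_segment ℝ _ _)
  · refine le_trans ?_ (key.trans ?_)
    · exact le_of_eq rfl
    · exact mul_le_mul_of_nonneg_left ((v - u).norm_coe_le_norm x) hc.le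
  · intro y hy
    rw [segment_eq_image_lineMap] at hy
    obtain ⟨θ, hθ, rfl⟩ := hy
    have hw : AffineMap.lineMap u v θ ∈ Metric.ball u δ :=
      (convex_ball u δ).segment_subset (Metric.mem_ball_self hδ) hv
        (segment_eq_image_lineMap ℝ u v ▸ mem_image_of_mem _ hθ)
    have h1 := hD hw
    have h2 := (ContinuousMap.dist_apply_le_dist x).trans h1.le
    have h3 : (AffineMap.lineMap u v θ : C(K, E)) x = AffineMap.lineMap (u x) (v x) θ := by
      simp [AffineMap.lineMap_apply]
    simpa [D, h3, dist_eq_norm] using h2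

/-- Post-composition with a `Cⁿ` map is a `Cⁿ` map between spaces of continuous functions. The
induction on `n` replaces `f : E → F` by `fderiv ℝ f : E → (E →L[ℝ] F)`, hence the common
universe of `E` and `F`. -/
theorem contDiff_comp_left {E : Type u} [NormedAddCommGroup E] [NormedSpace ℝ E] (n : ℕ) :
    ∀ {F : Type u} [NormedAddCommGroup F] [NormedSpace ℝ F] {f : E → F}
      (hf : ContDiff ℝ n f),
    ContDiff ℝ n (fun v : C(K, E) => (⟨f, hf.continuous⟩ : C(E, F)).comp v) := by
  induction n with
  | zero =>
    intro F _ _ f hf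
    exact contDiff_zero.2 (ContinuousMap.continuous_postcomp _)
  | succ n ih =>
    intro F _ _ f hf
    have hf1 : ContDiff ℝ 1 f := hf.of_le (by norm_cast; omega)
    have hD : ContDiff ℝ n (fderiv ℝ f) := (contDiff_succ_iff_fderiv.1 hf).2.2
    refine (contDiff_succ_iff_fderiv (n := n)).2 ⟨
      fun u => (hasFDerivAt_comp_left (K := K) hf1 u).differentiableAt,
      fun h => absurd h (WithTop.coe_ne_top (a := (n : ℕ∞))), ?_⟩
    have : fderiv ℝ (fun v : C(K, E) => (⟨f, hf.continuous⟩ : C(E, F)).comp v) =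
        fun u => pointwiseApplyL K E F
          ((⟨fderiv ℝ f, hD.continuous⟩ : C(E, E →L[ℝ] F)).comp u) :=
      funext fun u => (hasFDerivAt_comp_left hf1 u).fderiv
    rw [this]
    exact (pointwiseApplyL K E F).contDiff.comp (ih hD)

end ContinuousMap

/-! ### The integral operator on `C([-1, 1], E)` -/

section Integral

variable {E : Type*} [NormedAddCommGroup E] [NormedSpace ℝ E]

/-- The operator `u ↦ (s ↦ ∫₀ˢ u)` on continuous functions on `[-1, 1]`. -/
def integralFromZeroL (E : Type*) [NormedAddCommGroup E] [NormedSpace ℝ E] :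
    C(Icc (-1 : ℝ) 1, E) →L[ℝ] C(Icc (-1 : ℝ) 1, E) :=
  LinearMap.mkContinuous
    { toFun := fun u =>
        ⟨fun s => ∫ τ in (0 : ℝ)..s, u (projIcc (-1) 1 (by norm_num) τ), by
          have : Continuous fun τ : ℝ => u (projIcc (-1) 1 (by norm_num) τ) :=
            u.continuous.comp continuous_projIcc
          exact (intervalIntegral.continuous_primitive (fun a b => this.intervalIntegrable a b)
            0).comp continuous_subtype_val⟩
      map_add' := fun u v => by
        ext s
        exact intervalIntegral.integral_add
          ((u.continuous.comp continuous_projIcc).intervalIntegrable _ _)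
          ((v.continuous.comp continuous_projIcc).intervalIntegrable _ _)
      map_smul' := fun c u => by
        ext s
        exact intervalIntegral.integral_smul c _ }
    1 (fun u => by
      rw [ContinuousMap.norm_le _ (by positivity)]
      intro s
      refine (intervalIntegral.norm_integral_le_of_norm_le_const (C := ‖u‖)
        fun τ _ => u.norm_coe_le_norm _).trans ?_
      rw [one_mul, sub_zero]
      exact mul_le_of_le_one_right (norm_nonneg _) (abs_le.2 s.2))

end Integral

/-! ### Smooth local flows on Banach spaces -/

section LocalFlow

variable {E : Type*} [NormedAddCommGroup E] [NormedSpace ℝ E]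

/-- Constant functions, as a bounded linear map into the continuous functions on `[-1, 1]`. -/
def constIccL (E : Type*) [NormedAddCommGroup E] [NormedSpace ℝ E] :
    E →L[ℝ] C(Icc (-1 : ℝ) 1, E) :=
  LinearMap.mkContinuous
    { toFun := fun x => ContinuousMap.const _ x
      map_add' := fun x y => by ext; simp
      map_smul' := fun c x => by ext; simp }
    1 (fun x => by
      rw [ContinuousMap.norm_le _ (by positivity)]
      intro s
      simp)

@[simp] theorem constIccL_apply (x : E) (s : Icc (-1 : ℝ) 1) : constIccL E x s = x := rfl

/-- The map `((a, x), u) ↦ u - x - a ∫₀ g(u)`. Its zeros are the solutions `u` on `[-1, 1]` of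
`u' = a g(u)` with `u 0 = x`. -/
def rescaledODE {g : E → E} (hg : Continuous g) (p : (ℝ × E) × C(Icc (-1 : ℝ) 1, E)) :
    C(Icc (-1 : ℝ) 1, E) :=
  p.2 - constIccL E p.1.2 - p.1.1 • integralFromZeroL E ((⟨g, hg⟩ : C(E, E)).comp p.2)

theorem rescaledODE_eq_zero_iff {g : E → E} (hg : Continuous g) {a : ℝ} {x : E}
    {u : C(Icc (-1 : ℝ) 1, E)} :
    rescaledODE hg ((a, x), u) = 0 ↔ ∀ s : Icc (-1 : ℝ) 1,
      u s = x + a • ∫ τ in (0 : ℝ)..s, g (u (projIcc (-1) 1 (by norm_num) τ)) := by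
  have key : ∀ s, rescaledODE hg ((a, x), u) s =
      u s - (x + a • ∫ τ in (0 : ℝ)..s, g (u (projIcc (-1) 1 (by norm_num) τ))) := fun s =>
    sub_sub _ _ _
  rw [ContinuousMap.ext_iff]
  simp only [key, ContinuousMap.zero_apply, sub_eq_zero]

theorem contDiff_rescaledODE {n : ℕ} {g : E → E} (hg : ContDiff ℝ n g) :
    ContDiff ℝ n (rescaledODE hg.continuous) := by
  have h1 := ContinuousMap.contDiff_comp_left (K := Icc (-1 : ℝ) 1) n hg
  have h2 : ContDiff ℝ n fun p : (ℝ × E) × C(Icc (-1 : ℝ) 1, E) =>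
      integralFromZeroL E ((⟨g, hg.continuous⟩ : C(E, E)).comp p.2) :=
    (integralFromZeroL E).contDiff.comp (h1.comp contDiff_snd)
  have h3 : ContDiff ℝ n fun p : (ℝ × E) × C(Icc (-1 : ℝ) 1, E) => constIccL E p.1.2 :=
    (constIccL E).contDiff.comp (contDiff_snd.comp contDiff_fst)
  exact (contDiff_snd.sub h3).sub ((contDiff_fst.comp contDiff_fst).smul h2)

/-- Restricting a solution of `u' = a g(u)` to `[-|s|, |s|]` and rescaling gives a solution of
`w' = s a g(w)`. -/
theorem rescaledODE_comp_mul {g : E → E} (hg : Continuous g) {a : ℝ} {x : E}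
    {u : C(Icc (-1 : ℝ) 1, E)} (hu : rescaledODE hg ((a, x), u) = 0) (s : Icc (-1 : ℝ) 1)
    (m : C(Icc (-1 : ℝ) 1, Icc (-1 : ℝ) 1)) (hm : ∀ σ, (m σ : ℝ) = s * σ) :
    rescaledODE hg ((s * a, x), u.comp m) = 0 := by
  rw [rescaledODE_eq_zero_iff] at hu ⊢
  intro σ
  rw [ContinuousMap.comp_apply, hu (m σ), hm, mul_comm (s : ℝ) a, mul_smul]
  have := intervalIntegral.smul_integral_comp_mul_left (a := 0) (b := (σ : ℝ))
    (fun τ => g (u (projIcc (-1) 1 (by norm_num) τ))) (s : ℝ)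
  rw [mul_zero] at this
  rw [← this]
  congr 3
  refine intervalIntegral.integral_congr fun τ hτ => ?_
  have hτ' : τ ∈ Icc (-1 : ℝ) 1 :=
    (uIcc_subset_Icc (by norm_num) σ.2) hτ
  have h1 : projIcc (-1 : ℝ) 1 (by norm_num) (s * τ) = m ⟨τ, hτ'⟩ := by
    have : (s : ℝ) * τ = m ⟨τ, hτ'⟩ := (hm ⟨τ, hτ'⟩).symm
    rw [this, projIcc_val]
  simp only [ContinuousMap.comp_apply, h1, projIcc_of_mem (by norm_num : (-1 : ℝ) ≤ 1) hτ']

variable [CompleteSpace E]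

/-- The flow of a `Cⁿ` vector field `g` on a Banach space is `Cⁿ` near `(0, x₀)`: it is obtained by
applying the implicit function theorem to `rescaledODE` and evaluating the solution at time `1`. -/
theorem ContDiff.exists_contDiffAt_localFlow {n : ℕ} (hn : n ≠ 0) {g : E → E}
    (hg : ContDiff ℝ n g) (x₀ : E) :
    ∃ Φ : ℝ × E → E, ContDiffAt ℝ n Φ (0, x₀) ∧ ∃ ε > 0, ∀ᶠ x in 𝓝 x₀, Φ (0, x) = x ∧
      ∀ a ∈ Ioo (-ε) ε, HasDerivAt (fun b => Φ (b, x)) (g (Φ (a, x))) a := by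
  set F := rescaledODE hg.continuous with hF
  set u₀ : (ℝ × E) × C(Icc (-1 : ℝ) 1, E) := ((0, x₀), constIccL E x₀) with hu₀
  have cdf : ContDiffAt ℝ n F u₀ := (contDiff_rescaledODE hg).contDiffAt
  have pn : (n : ℕ∞ω) ≠ 0 := by exact_mod_cast hn
  have hF0 : F u₀ = 0 := by
    rw [hF, hu₀, rescaledODE_eq_zero_iff]; simp
  -- At `a = 0` the map is `u ↦ u - x₀`, whose derivative is the identity.
  have inv : (fderiv ℝ F u₀ ∘L .inr ℝ (ℝ × E) C(Icc (-1 : ℝ) 1, E)).IsInvertible := by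
    have h1 : HasFDerivAt (fun u => F ((0, x₀), u))
        (fderiv ℝ F u₀ ∘L .inr ℝ (ℝ × E) C(Icc (-1 : ℝ) 1, E)) (constIccL E x₀) :=
      (cdf.differentiableAt pn).hasFDerivAt.comp (constIccL E x₀)
        (hasFDerivAt_prodMk_right (0, x₀) (constIccL E x₀))
    have h2 : HasFDerivAt (fun u => F ((0, x₀), u))
        (ContinuousLinearMap.id ℝ C(Icc (-1 : ℝ) 1, E)) (constIccL E x₀) := by
      have : (fun u => F ((0, x₀), u)) = fun u => u - constIccL E x₀ := by
        funext u; simp [hF, rescaledODE]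
      rw [this]
      exact (hasFDerivAt_id _).sub_const _
    rw [h1.unique h2]
    exact ⟨ContinuousLinearEquiv.refl ℝ _, rfl⟩
  set Ψ := cdf.implicitFunction pn inv with hΨ
  have hΨ0 : Ψ (0, x₀) = constIccL E x₀ := cdf.implicitFunction_apply_self pn inv
  have hΨs : ContDiffAt ℝ n Ψ (0, x₀) := cdf.contDiffAt_implicitFunction pn inv
  have ev1 : ∀ᶠ p in 𝓝 ((0 : ℝ), x₀), F (p, Ψ p) = 0 := by
    simpa only [hF0] using cdf.eventually_apply_implicitFunction pn inv
  have ev2 : ∀ᶠ v in 𝓝 u₀, F v = 0 ↔ Ψ v.1 = v.2 := by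
    simpa only [hF0] using cdf.eventually_apply_eq_iff_implicitFunction pn inv
  obtain ⟨δ, hδ, H2⟩ := Metric.eventually_nhds_iff.1 ev2
  have ev3 : ∀ᶠ p in 𝓝 ((0 : ℝ), x₀), Dist.dist (Ψ p) (constIccL E x₀) < δ := by
    have := hΨs.continuousAt (Metric.ball_mem_nhds _ hδ)
    rw [hΨ0] at this
    exact this
  obtain ⟨η, hη, H1⟩ := Metric.eventually_nhds_iff.1 (ev1.and ev3)
  set ε := min δ η / 2 with hε
  have hε0 : 0 < ε := by positivity
  have hεδ : ε < δ := lt_of_lt_of_le (half_lt_self (by positivity)) (min_le_left _ _)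
  have hεη : ε < η := lt_of_lt_of_le (half_lt_self (by positivity)) (min_le_right _ _)
  have one_mem : (1 : ℝ) ∈ Icc (-1 : ℝ) 1 := by norm_num
  -- The solution `Ψ (a, x)` for `|a| ≤ ε` is a rescaled restriction of `Ψ (ε, x)`.
  have main : ∀ x ∈ Metric.ball x₀ ε, ∀ s : Icc (-1 : ℝ) 1,
      Ψ (s * ε, x) ⟨1, one_mem⟩ = Ψ (ε, x) s := by
    intro x hx s
    have hp : Dist.dist (ε, x) (0, x₀) < η := by
      rw [Prod.dist_eq, max_lt_iff, Real.dist_eq, sub_zero, abs_of_pos hε0]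
      exact ⟨hεη, (Metric.mem_ball.1 hx).trans hεη⟩
    obtain ⟨hz, hd⟩ := H1 hp
    let m : C(Icc (-1 : ℝ) 1, Icc (-1 : ℝ) 1) :=
      ⟨fun σ => ⟨s * σ, by
        refine abs_le.1 ?_
        rw [abs_mul]
        exact mul_le_one₀ (abs_le.2 s.2) (abs_nonneg _) (abs_le.2 σ.2)⟩, by fun_prop⟩
    have hw := rescaledODE_comp_mul hg.continuous hz s m (fun σ => rfl)
    have hwd : Dist.dist ((Ψ (ε, x)).comp m) (constIccL E x₀) < δ := by
      refine lt_of_le_of_lt ?_ hd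
      rw [ContinuousMap.dist_le dist_nonneg]
      exact fun σ => ContinuousMap.dist_apply_le_dist (f := Ψ (ε, x)) (g := constIccL E x₀) (m σ)
    have hsε : |(s : ℝ) * ε| ≤ ε := by
      rw [abs_mul, abs_of_pos hε0]
      exact mul_le_of_le_one_left hε0.le (abs_le.2 s.2)
    have := (H2 (y := (((s : ℝ) * ε, x), (Ψ (ε, x)).comp m)) (by
      rw [hu₀, Prod.dist_eq, Prod.dist_eq, max_lt_iff, max_lt_iff, Real.dist_eq, sub_zero]
      exact ⟨⟨hsε.trans_lt hεδ, (Metric.mem_ball.1 hx).trans hεδ⟩, hwd⟩)).1 hw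
    rw [this]
    change Ψ (ε, x) (m ⟨1, one_mem⟩) = _
    congr 1
    exact Subtype.ext (mul_one _)
  refine ⟨fun p => Ψ p ⟨1, one_mem⟩, ?_, ε, hε0, ?_⟩
  · exact (ContinuousMap.evalCLM ℝ (⟨1, one_mem⟩ : Icc (-1 : ℝ) 1)).contDiff.contDiffAt.comp _ hΨs
  filter_upwards [Metric.ball_mem_nhds x₀ hε0] with x hx
  have hp : Dist.dist (ε, x) (0, x₀) < η := by
    rw [Prod.dist_eq, max_lt_iff, Real.dist_eq, sub_zero, abs_of_pos hε0]
    exact ⟨hεη, (Metric.mem_ball.1 hx).trans hεη⟩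
  have hz := (rescaledODE_eq_zero_iff hg.continuous).1 (H1 hp).1
  set U : ℝ → E := fun τ => g (Ψ (ε, x) (projIcc (-1) 1 (by norm_num) τ)) with hU
  have hUc : Continuous U :=
    hg.continuous.comp ((Ψ (ε, x)).continuous.comp continuous_projIcc)
  have hmem : ∀ a ∈ Ioo (-ε) ε, a / ε ∈ Icc (-1 : ℝ) 1 := fun a ha => by
    refine abs_le.1 ?_
    rw [abs_div, abs_of_pos hε0, div_le_one hε0]
    exact (abs_lt.2 ha).le
  have hformula : ∀ a ∈ Ioo (-ε) ε, ∀ ha : a / ε ∈ Icc (-1 : ℝ) 1,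
      Ψ (a, x) ⟨1, one_mem⟩ = Ψ (ε, x) ⟨a / ε, ha⟩ := fun a _ ha' => by
    have := main x hx ⟨a / ε, ha'⟩
    rwa [show ((⟨a / ε, ha'⟩ : Icc (-1 : ℝ) 1) : ℝ) * ε = a from div_mul_cancel₀ a hε0.ne'] at this
  constructor
  · have h0 : (0 : ℝ) ∈ Ioo (-ε) ε := ⟨neg_lt_zero.2 hε0, hε0⟩
    have := hformula 0 h0 (hmem 0 h0)
    change Ψ (0, x) ⟨1, one_mem⟩ = x
    rw [this, hz]
    simp
  · intro a ha
    have hval : g (Ψ (a, x) ⟨1, one_mem⟩) = U (a / ε) := by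
      rw [hformula a ha (hmem a ha), hU]
      simp only [projIcc_of_mem (by norm_num : (-1 : ℝ) ≤ 1) (hmem a ha)]
    have hd : HasDerivAt (fun b : ℝ => x + ε • ∫ τ in (0 : ℝ)..b / ε, U τ) (U (a / ε)) a := by
      have h1 : HasDerivAt (fun c : ℝ => ∫ τ in (0 : ℝ)..c, U τ) (U (a / ε)) (a / ε) :=
        intervalIntegral.integral_hasDerivAt_right (hUc.intervalIntegrable _ _)
          (hUc.stronglyMeasurableAtFilter _ _) hUc.continuousAt
      have h2 : HasDerivAt (fun b : ℝ => b / ε) (1 / ε) a := (hasDerivAt_id a).div_const ε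
      have h3 := ((h1.scomp a h2).const_smul ε).const_add x
      rw [smul_smul, mul_one_div_cancel hε0.ne', one_smul] at h3
      exact h3
    rw [hval]
    refine hd.congr_of_eventuallyEq ?_
    filter_upwards [Ioo_mem_nhds ha.1 ha.2] with b hb
    rw [hformula b hb (hmem b hb), hz]

end LocalFlow

/-! ### Smooth local flows on manifolds -/

section LocalFlowAt

variable {E : Type*} [NormedAddCommGroup E] [NormedSpace ℝ E] [CompleteSpace E] [HasContDiffBump E]

/-- The local flow of a vector field that is only assumed `Cⁿ` at `x₀`; for a short time it stays in
a given neighbourhood `U` of `x₀`. -/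
theorem ContDiffAt.exists_contDiffAt_localFlow {n : ℕ} (hn : n ≠ 0) {g : E → E} {x₀ : E}
    (hg : ContDiffAt ℝ n g x₀) {U : Set E} (hU : U ∈ 𝓝 x₀) :
    ∃ Φ : ℝ × E → E, ContDiffAt ℝ n Φ (0, x₀) ∧ Φ (0, x₀) = x₀ ∧
      ∃ ε > 0, ∀ᶠ x in 𝓝 x₀, Φ (0, x) = x ∧
      ∀ a ∈ Ioo (-ε) ε, Φ (a, x) ∈ U ∧ HasDerivAt (fun b => Φ (b, x)) (g (Φ (a, x))) a := by
  obtain ⟨r, hr, hgr⟩ := Metric.eventually_nhds_iff_ball.1 (hg.eventually (by simp))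
  -- Multiplying `g` by a bump function makes it globally `Cⁿ` without changing it near `x₀`.
  let f : ContDiffBump x₀ := ⟨r / 3, r / 2, by positivity, by linarith⟩
  have hfg : ContDiff ℝ n fun x => f x • g x := by
    rw [contDiff_iff_contDiffAt]
    intro x
    by_cases hx : x ∈ Metric.ball x₀ r
    · exact f.contDiff.contDiffAt.smul (hgr x hx)
    · have h0 : x ∉ tsupport f := by
        rw [f.tsupport_eq]
        exact fun h => hx (Metric.closedBall_subset_ball (by simp only [f]; linarith) h)
      have h1 : (fun x => f x • g x) =ᶠ[𝓝 x] fun _ => 0 := by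
        filter_upwards [notMem_tsupport_iff_eventuallyEq.1 h0] with y hy
        simp [hy]
      exact contDiffAt_const.congr_of_eventuallyEq h1
  obtain ⟨Φ, hΦ, ε, hε, h⟩ := hfg.exists_contDiffAt_localFlow hn x₀
  have h0 : Φ (0, x₀) = x₀ := h.self_of_nhds.1
  have hin : ∀ᶠ p in 𝓝 ((0 : ℝ), x₀), Φ p ∈ U ∩ Metric.ball x₀ (r / 3) :=
    hΦ.continuousAt.eventually_mem
      (by rw [h0]; exact inter_mem hU (Metric.ball_mem_nhds _ (by positivity)))
  rw [nhds_prod_eq] at hin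
  obtain ⟨P, hP, Q, hQ, hPQ⟩ := eventually_prod_iff.1 hin
  obtain ⟨δ, hδ, hPδ⟩ := Metric.eventually_nhds_iff_ball.1 hP
  refine ⟨Φ, hΦ, h0, min ε δ, lt_min hε hδ, ?_⟩
  filter_upwards [h, hQ] with x hx hQx
  refine ⟨hx.1, fun a ha => ?_⟩
  have haε : a ∈ Ioo (-ε) ε :=
    Ioo_subset_Ioo (neg_le_neg (min_le_left _ _)) (min_le_left _ _) ha
  have haδ : a ∈ Metric.ball (0 : ℝ) δ := by
    rw [Real.ball_eq_Ioo, zero_sub, zero_add]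
    exact Ioo_subset_Ioo (neg_le_neg (min_le_right _ _)) (min_le_right _ _) ha
  have hmem := hPQ (hPδ a haδ) hQx
  refine ⟨hmem.1, ?_⟩
  have h1 : f (Φ (a, x)) = 1 := f.one_of_mem_closedBall (Metric.ball_subset_closedBall hmem.2)
  simpa only [h1, one_smul] using hx.2 a haε

end LocalFlowAt

section ManifoldLocalFlow

variable {E : Type*} [NormedAddCommGroup E] [NormedSpace ℝ E]
  {H : Type*} [TopologicalSpace H] {I : ModelWithCorners ℝ E H} [I.Boundaryless]
  {M : Type*} [TopologicalSpace M] [ChartedSpace H M] [IsManifold I ∞ M]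
  {v : (x : M) → TangentSpace I x}

/-- A smooth vector field, read in the chart at `x₀`, is smooth at the image of `x₀`. -/
theorem ContMDiff.contDiffAt_tangentCoordChange
    (hv : ContMDiff I I.tangent ∞ (fun x => (⟨x, v x⟩ : TangentBundle I M))) (x₀ : M) :
    ContDiffAt ℝ ∞ (fun y : E =>
      tangentCoordChange I ((extChartAt I x₀).symm y) x₀ ((extChartAt I x₀).symm y)
        (v ((extChartAt I x₀).symm y) : E)) (extChartAt I x₀ x₀) := by
  have h := (contMDiffAt_iff.1 (hv x₀)).2.contDiffAt (by rw [I.range_eq_univ]; exact univ_mem)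
  exact h.snd

/-- The inverse of the chart at `x₀` carries integral curves of the coordinate representation of `v`
to integral curves of `v`. -/
theorem hasMFDerivAt_extChartAt_symm_comp {x₀ : M} {f : ℝ → E} {t : ℝ}
    (ht : f t ∈ (extChartAt I x₀).target)
    (h : HasDerivAt f (tangentCoordChange I ((extChartAt I x₀).symm (f t)) x₀
      ((extChartAt I x₀).symm (f t)) (v ((extChartAt I x₀).symm (f t)) : E)) t) :
    HasMFDerivAt 𝓘(ℝ, ℝ) I (fun s => (extChartAt I x₀).symm (f s)) t
      ((1 : ℝ →L[ℝ] ℝ).smulRight (v ((extChartAt I x₀).symm (f t)))) := by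
  set xt : M := (extChartAt I x₀).symm (f t) with hxt
  have hft1 : xt ∈ (extChartAt I x₀).source := (extChartAt I x₀).map_target ht
  have hft2 := mem_extChartAt_source (I := I) xt
  have key : HasDerivAt ((extChartAt I xt ∘ (extChartAt I x₀).symm) ∘ f) (v xt : E) t := by
    have hD : HasFDerivAt (extChartAt I xt ∘ (extChartAt I x₀).symm)
        (tangentCoordChange I x₀ xt xt) (f t) := by
      have := hasFDerivWithinAt_tangentCoordChange (I := I) ⟨hft1, hft2⟩
      rwa [I.range_eq_univ, hasFDerivWithinAt_univ, hxt, (extChartAt I x₀).right_inv ht] at this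
    have := hD.comp_hasDerivAt t h
    exact this.congr_deriv ((tangentCoordChange_comp (x := x₀) ⟨⟨hft2, hft1⟩, hft2⟩).trans
      (tangentCoordChange_self (I := I) (x := xt) (z := xt) (v := (v xt : E)) hft2))
  refine ⟨(continuousAt_extChartAt_symm'' ht).comp h.continuousAt, ?_⟩
  have h2 : HasFDerivWithinAt ((extChartAt I xt ∘ (extChartAt I x₀).symm) ∘ f)
      ((1 : ℝ →L[ℝ] ℝ).smulRight (v xt : E)) (range 𝓘(ℝ, ℝ)) t := by
    have aux : ∀ w : E, ContinuousLinearMap.toSpanSingleton ℝ w =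
        (1 : ℝ →L[ℝ] ℝ).smulRight w := fun w => by ext; simp
    exact (key.hasFDerivAt.congr_fderiv (aux _)).hasFDerivWithinAt
  exact h2

/-- The local flow of a smooth vector field on a manifold is `Cⁿ` near `(0, x₀)`. -/
theorem ContMDiff.exists_contMDiffAt_localFlow [CompleteSpace E] [HasContDiffBump E]
    {n : ℕ} (hn : n ≠ 0)
    (hv : ContMDiff I I.tangent ∞ (fun x => (⟨x, v x⟩ : TangentBundle I M))) (x₀ : M) :
    ∃ Φ : ℝ → M → M, ContMDiffAt (𝓘(ℝ, ℝ).prod I) I n (fun p : ℝ × M => Φ p.1 p.2) (0, x₀) ∧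
      ∃ ε > 0, ∀ᶠ x in 𝓝 x₀, Φ 0 x = x ∧
        IsMIntegralCurveOn (fun t => Φ t x) v (Ioo (-ε) ε) := by
  set e := extChartAt I x₀ with he
  have hsrc : e.source ∈ 𝓝 x₀ := extChartAt_source_mem_nhds x₀
  obtain ⟨Φ, hΦ, h0, ε, hε, h⟩ := ((hv.contDiffAt_tangentCoordChange x₀).of_le
    (by exact_mod_cast le_top : (n : ℕ∞ω) ≤ ∞)).exists_contDiffAt_localFlow hn
      (extChartAt_target_mem_nhds x₀)
  refine ⟨fun a q => e.symm (Φ (a, e q)), ?_, ε, hε, ?_⟩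
  · have h1 : ContMDiffAt (𝓘(ℝ, ℝ).prod I) 𝓘(ℝ, ℝ × E) n
        (fun p : ℝ × M => (p.1, e p.2)) (0, x₀) :=
      contMDiffAt_fst.prodMk_space
        (ContMDiffAt.comp (I' := I) (0, x₀)
          (contMDiffAt_extChartAt (I := I) (x := x₀) (n := n)) contMDiffAt_snd)
    have h2 : ContMDiffAt 𝓘(ℝ, ℝ × E) 𝓘(ℝ, E) n Φ (0, e x₀) := hΦ.contMDiffAt
    have h3 : ContMDiffAt 𝓘(ℝ, E) I n e.symm (Φ (0, e x₀)) := by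
      rw [h0]
      exact (contMDiffOn_extChartAt_symm x₀).contMDiffAt (extChartAt_target_mem_nhds x₀)
    exact ContMDiffAt.comp (I' := 𝓘(ℝ, E)) (0, x₀) h3
      (ContMDiffAt.comp (I' := 𝓘(ℝ, ℝ × E)) (0, x₀) h2 h1)
  · filter_upwards [(continuousAt_extChartAt x₀).eventually h, hsrc] with q hq hqs
    refine ⟨by rw [hq.1, e.left_inv hqs], fun t ht => ?_⟩
    exact (hasMFDerivAt_extChartAt_symm_comp (f := fun a => Φ (a, e q)) (hq.2 t ht).1
      (hq.2 t ht).2).hasMFDerivWithinAt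

end ManifoldLocalFlow

/-! ### Flows of complete vector fields -/

section CompleteFlow

variable {E : Type*} [NormedAddCommGroup E] [NormedSpace ℝ E]
  {H : Type*} [TopologicalSpace H] {I : ModelWithCorners ℝ E H} [I.Boundaryless]
  {M : Type*} [TopologicalSpace M] [T2Space M] [ChartedSpace H M] [IsManifold I ∞ M]
  {v : (x : M) → TangentSpace I x}

/-- On a Hausdorff manifold, any family of integral curves of a smooth vector field which start near
`x₀` and exist for a uniform time depends smoothly on time and starting point near `(0, x₀)`. -/
theorem ContMDiff.contMDiffAt_zero_of_isMIntegralCurveOn [CompleteSpace E] [HasContDiffBump E]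
    (n : ℕ)
    (hv : ContMDiff I I.tangent ∞ (fun x => (⟨x, v x⟩ : TangentBundle I M))) {x₀ : M}
    {θ : ℝ → M → M} {ε : ℝ} (hε : 0 < ε)
    (hθ : ∀ᶠ x in 𝓝 x₀, θ 0 x = x ∧ IsMIntegralCurveOn (fun t => θ t x) v (Ioo (-ε) ε)) :
    ContMDiffAt (𝓘(ℝ, ℝ).prod I) I n (fun p : ℝ × M => θ p.1 p.2) (0, x₀) := by
  have : IsManifold I 1 M := .of_le (n := ∞) (by exact_mod_cast le_top)
  have hv1 : ContMDiff I I.tangent 1 (fun x => (⟨x, v x⟩ : TangentBundle I M)) :=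
    hv.of_le (by exact_mod_cast le_top)
  obtain ⟨Φ, hΦ, δ, hδ, h⟩ := hv.exists_contMDiffAt_localFlow (n := n + 1) (by omega) x₀
  refine (hΦ.of_le (by norm_cast; omega)).congr_of_eventuallyEq ?_
  have hm : 0 < min ε δ := lt_min hε hδ
  have ht : ∀ᶠ t in 𝓝 (0 : ℝ), t ∈ Ioo (-min ε δ) (min ε δ) :=
    Ioo_mem_nhds (neg_lt_zero.2 hm) hm
  rw [nhds_prod_eq]
  filter_upwards [ht.prod_mk (hθ.and h)] with p hp
  obtain ⟨hp1, hp2, hp3⟩ := hp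
  exact isMIntegralCurveOn_Ioo_eqOn_of_contMDiff_boundaryless
    ⟨neg_lt_zero.2 hm, hm⟩ hv1
    (hp2.2.mono (Ioo_subset_Ioo (neg_le_neg (min_le_left _ _)) (min_le_left _ _)))
    (hp3.2.mono (Ioo_subset_Ioo (neg_le_neg (min_le_right _ _)) (min_le_right _ _)))
    (hp2.1.trans hp3.1.symm) hp1

variable {θ : ℝ → M → M}

/-- The group law of the flow of a complete vector field. -/
theorem ContMDiff.flow_add
    (hv : ContMDiff I I.tangent ∞ (fun x => (⟨x, v x⟩ : TangentBundle I M)))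
    (h0 : ∀ x, θ 0 x = x) (hθ : ∀ x, IsMIntegralCurve (fun t => θ t x) v) (s t : ℝ) (x : M) :
    θ (s + t) x = θ s (θ t x) := by
  have : IsManifold I 1 M := .of_le (n := ∞) (by exact_mod_cast le_top)
  have hv1 : ContMDiff I I.tangent 1 (fun x => (⟨x, v x⟩ : TangentBundle I M)) :=
    hv.of_le (by exact_mod_cast le_top)
  exact congrFun (isMIntegralCurve_Ioo_eq_of_contMDiff_boundaryless (t₀ := 0) hv1
    ((hθ x).comp_add t) (hθ (θ t x)) (by simp [h0])) s

/-- The flow of a complete smooth vector field on a Hausdorff manifold is smooth: by the group law,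
the set of times at which it is `Cⁿ` along a given integral curve is open and closed. -/
theorem ContMDiff.contMDiff_flow [CompleteSpace E] [HasContDiffBump E]
    (hv : ContMDiff I I.tangent ∞ (fun x => (⟨x, v x⟩ : TangentBundle I M)))
    (h0 : ∀ x, θ 0 x = x) (hθ : ∀ x, IsMIntegralCurve (fun t => θ t x) v) :
    ContMDiff (𝓘(ℝ, ℝ).prod I) I ∞ (fun p : ℝ × M => θ p.1 p.2) := by
  have : IsManifold I 1 M := .of_le (n := ∞) (by exact_mod_cast le_top)
  rintro ⟨t₀, x₀⟩
  rw [contMDiffAt_infty]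
  intro n
  -- For finite `n`, unlike for `∞`, being `Cⁿ` at a point is an open condition.
  have : IsManifold I n M := .of_le (n := ∞) (by exact_mod_cast le_top)
  have hloc : ∀ x, ∀ᶠ p in 𝓝 ((0 : ℝ), x),
      ContMDiffAt (𝓘(ℝ, ℝ).prod I) I n (fun p : ℝ × M => θ p.1 p.2) p := fun x =>
    (contMDiffAt_iff_contMDiffAt_nhds (by simp)).1
      (hv.contMDiffAt_zero_of_isMIntegralCurveOn n one_pos
        (Eventually.of_forall fun y => ⟨h0 y, (hθ y).isMIntegralCurveOn _⟩))
  -- The group law carries regularity at time `s` to regularity at time `t`.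
  have step : ∀ s t, ContMDiffAt (𝓘(ℝ, ℝ).prod I) I n (fun p : ℝ × M => θ p.1 p.2)
      (t - s, θ s x₀) →
      ContMDiffAt (𝓘(ℝ, ℝ).prod I) I n (fun p : ℝ × M => θ p.1 p.2) (s, x₀) →
      ContMDiffAt (𝓘(ℝ, ℝ).prod I) I n (fun p : ℝ × M => θ p.1 p.2) (t, x₀) := by
    intro s t h1 h2
    have h3 : ContMDiffAt I I n (fun x => θ s x) x₀ :=
      ContMDiffAt.comp (I' := 𝓘(ℝ, ℝ).prod I) x₀ (g := fun p : ℝ × M => θ p.1 p.2)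
        (f := fun x => (s, x)) h2 (contMDiffAt_const.prodMk contMDiffAt_id)
    have h4 : ContMDiffAt (𝓘(ℝ, ℝ).prod I) (𝓘(ℝ, ℝ).prod I) n
        (fun p : ℝ × M => (p.1 - s, θ s p.2)) (t, x₀) :=
      (contMDiffAt_fst.sub contMDiffAt_const).prodMk
        (ContMDiffAt.comp (I' := I) (t, x₀) (g := fun x => θ s x) (f := Prod.snd)
          h3 contMDiffAt_snd)
    have h5 := ContMDiffAt.comp (I' := 𝓘(ℝ, ℝ).prod I) (t, x₀) h1 h4
    refine h5.congr_of_eventuallyEq (Eventually.of_forall fun p => ?_)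
    change θ p.1 p.2 = θ (p.1 - s) (θ s p.2)
    rw [← hv.flow_add h0 hθ, sub_add_cancel]
  have hP := PreconnectedSpace.induction₂' (α := ℝ)
    (fun s t => ContMDiffAt (𝓘(ℝ, ℝ).prod I) I n (fun p : ℝ × M => θ p.1 p.2) (s, x₀) ↔
      ContMDiffAt (𝓘(ℝ, ℝ).prod I) I n (fun p : ℝ × M => θ p.1 p.2) (t, x₀)) ?_
    ⟨fun _ _ _ => Iff.trans⟩ 0 t₀
  · exact hP.1 (hloc x₀).self_of_nhds
  · intro s
    have hc : ContinuousAt (fun t => θ t x₀) s := (hθ x₀).continuous.continuousAt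
    have c1 : Tendsto (fun t => (t - s, θ s x₀)) (𝓝 s) (𝓝 (0, θ s x₀)) := by
      have : ContinuousAt (fun t : ℝ => (t - s, θ s x₀)) s := by fun_prop
      simpa [ContinuousAt] using this
    have c2 : Tendsto (fun t => (s - t, θ t x₀)) (𝓝 s) (𝓝 (0, θ s x₀)) := by
      have : ContinuousAt (fun t : ℝ => (s - t, θ t x₀)) s := by fun_prop
      simpa [ContinuousAt] using this
    filter_upwards [c1.eventually (hloc _), c2.eventually (hloc _)] with t h1 h2
    have hst := Iff.intro (step s t h1) (step t s h2)
    exact ⟨hst, hst.symm⟩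

end CompleteFlow

/-! ### Time-dependent flows -/

section TimeDependent

variable {n : ℕ} {M : Type*} [TopologicalSpace M] [ChartedSpace (EuclideanSpace ℝ (Fin n)) M]
  {X : ℝ → ∀ p : M, TangentSpace (𝓡 n) p}

/-- The suspension of a time-dependent vector field `X`: the autonomous field `(1, X)` on `ℝ × M`,
whose integral curves are the graphs of the solutions of `γ' t = X t (γ t)`, up to translation. -/
def suspension (X : ℝ → ∀ p : M, TangentSpace (𝓡 n) p) (p : ℝ × M) :
    TangentSpace (𝓘(ℝ, ℝ).prod (𝓡 n)) p :=
  ((1 : ℝ), X p.1 p.2)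

theorem IsSmoothTimeDependent.contMDiff_suspension [IsManifold (𝓡 n) ∞ M]
    (hX : IsSmoothTimeDependent X) :
    ContMDiff (𝓘(ℝ, ℝ).prod (𝓡 n)) (𝓘(ℝ, ℝ).prod (𝓡 n)).tangent ∞
      (fun p => (⟨p, suspension X p⟩ : TangentBundle (𝓘(ℝ, ℝ).prod (𝓡 n)) (ℝ × M))) := by
  have h1 : ContMDiff 𝓘(ℝ, ℝ) 𝓘(ℝ, ℝ).tangent ∞
      (fun t : ℝ => (⟨t, (1 : ℝ)⟩ : TangentBundle 𝓘(ℝ, ℝ) ℝ)) := by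
    exact contMDiff_vectorSpace_iff_contDiff.2 contDiff_const
  exact contMDiff_equivTangentBundleProd_symm.comp ((h1.comp contMDiff_fst).prodMk hX)

theorem IsSmoothTimeDependent.contMDiff_apply [IsManifold (𝓡 n) ∞ M]
    (hX : IsSmoothTimeDependent X) (t : ℝ) :
    ContMDiff (𝓡 n) (𝓡 n).tangent ∞ (fun p => (⟨p, X t p⟩ : TangentBundle (𝓡 n) M)) :=
  ContMDiff.comp (I' := 𝓘(ℝ, ℝ).prod (𝓡 n)) (f := fun p : M => (t, p)) hX
    (contMDiff_const.prodMk contMDiff_id)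

theorem IsTimeDependentIntegralCurve.isMIntegralCurve_suspension {γ : ℝ → M}
    (hγ : IsTimeDependentIntegralCurve X γ) :
    IsMIntegralCurve (I := 𝓘(ℝ, ℝ).prod (𝓡 n)) (fun t => (t, γ t)) (suspension X) := by
  intro t
  refine ((hasMFDerivAt_id t).prodMk (hγ t)).congr_mfderiv ?_
  refine ContinuousLinearMap.ext fun s => ?_
  have h : ∀ r : ℝ, r = r * 1 := fun r => (mul_one r).symm
  exact Prod.ext (h s) rfl

variable [T2Space M] [IsManifold (𝓡 n) ∞ M]

/-- Uniqueness for the Cauchy problem of a smooth time-dependent vector field. -/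
theorem IsTimeDependentIntegralCurve.eq (hX : IsSmoothTimeDependent X) {γ γ' : ℝ → M}
    (hγ : IsTimeDependentIntegralCurve X γ) (hγ' : IsTimeDependentIntegralCurve X γ') {t₀ : ℝ}
    (h : γ t₀ = γ' t₀) : γ = γ' := by
  have : IsManifold (𝓘(ℝ, ℝ).prod (𝓡 n)) 1 (ℝ × M) :=
    .of_le (n := ∞) (by exact_mod_cast le_top)
  have := isMIntegralCurve_Ioo_eq_of_contMDiff_boundaryless (t₀ := t₀)
    (hX.contMDiff_suspension.of_le (by exact_mod_cast le_top))
    hγ.isMIntegralCurve_suspension hγ'.isMIntegralCurve_suspension (by simp only [h])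
  exact funext fun t => congrArg Prod.snd (congrFun this t)

theorem timeDependentFlow_comp (hXs : IsSmoothTimeDependent X) (hX : IsCompleteTimeDependent X)
    (t₂ t₁ t₀ : ℝ) (q : M) :
    timeDependentFlow hX t₂ t₁ (timeDependentFlow hX t₁ t₀ q) = timeDependentFlow hX t₂ t₀ q :=
  congrFun ((timeDependentFlow_isIntegralCurve hX t₁ _).eq hXs
    (timeDependentFlow_isIntegralCurve hX t₀ q) (t₀ := t₁) (timeDependentFlow_self hX t₁ _)) t₂

/-- The time-dependent flow `(t₁, t₀, q) ↦ φ^{t₁,t₀} q` is jointly smooth. -/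
theorem contMDiff_timeDependentFlow (hXs : IsSmoothTimeDependent X)
    (hX : IsCompleteTimeDependent X) :
    ContMDiff (𝓘(ℝ, ℝ).prod (𝓘(ℝ, ℝ).prod (𝓡 n))) (𝓡 n) ∞
      (fun p : ℝ × ℝ × M => timeDependentFlow hX p.1 p.2.1 p.2.2) := by
  have h := hXs.contMDiff_suspension.contMDiff_flow
    (θ := fun s p => (s + p.1, timeDependentFlow hX (s + p.1) p.1 p.2))
    (fun p => by simp [timeDependentFlow_self])
    (fun p => (timeDependentFlow_isIntegralCurve hX
      p.1 p.2).isMIntegralCurve_suspension.comp_add p.1)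
  have h1 : ContMDiff (𝓘(ℝ, ℝ).prod (𝓘(ℝ, ℝ).prod (𝓡 n)))
      (𝓘(ℝ, ℝ).prod (𝓘(ℝ, ℝ).prod (𝓡 n))) ∞
      (fun p : ℝ × ℝ × M => (p.1 - p.2.1, p.2)) :=
    (contMDiff_fst.sub (contMDiff_fst.comp contMDiff_snd)).prodMk contMDiff_snd
  have h2 := contMDiff_snd.comp (h.comp h1)
  refine h2.congr fun p => ?_
  simp

end TimeDependent

/-! ### The determinant and mixed derivatives -/

section Determinant

/-- The determinant is a smooth function on the endomorphisms of a Euclidean space. -/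
theorem contDiff_det_euclideanSpace {n : ℕ} {k : ℕ∞ω} :
    ContDiff ℝ k
      (fun A : EuclideanSpace ℝ (Fin n) →L[ℝ] EuclideanSpace ℝ (Fin n) => A.det) := by
  have h : (fun A : EuclideanSpace ℝ (Fin n) →L[ℝ] EuclideanSpace ℝ (Fin n) => A.det) =
      fun A => ∑ σ : Equiv.Perm (Fin n), ((Equiv.Perm.sign σ : ℤ) : ℝ) *
        ∏ i, EuclideanSpace.proj (𝕜 := ℝ) (σ i)
          (A ((EuclideanSpace.basisFun (Fin n) ℝ).toBasis i)) := by
    funext A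
    rw [ContinuousLinearMap.det, ← LinearMap.det_toMatrix
      (EuclideanSpace.basisFun (Fin n) ℝ).toBasis, Matrix.det_apply']
    refine Finset.sum_congr rfl fun σ _ => congrArg _ (Finset.prod_congr rfl fun i _ => ?_)
    simp [LinearMap.toMatrix_apply]
  rw [h]
  refine ContDiff.sum fun σ _ => contDiff_const.mul (contDiff_prod fun i _ => ?_)
  exact (EuclideanSpace.proj (𝕜 := ℝ) (σ i)).contDiff.comp
    (ContinuousLinearMap.apply ℝ (EuclideanSpace ℝ (Fin n))
      ((EuclideanSpace.basisFun (Fin n) ℝ).toBasis i)).contDiff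

end Determinant

section MixedDerivative

/-- By the symmetry of second derivatives, the space derivatives of a `C²` family `G (s, ·)` of maps
evolve, at `s = s₀`, by the derivative of the velocity field `V` of the family. -/
theorem hasDerivAt_fderiv_comp_inr {E : Type*} [NormedAddCommGroup E] [NormedSpace ℝ E]
    {G : ℝ × E → E} {V : E → E} {s₀ : ℝ} {x₀ : E} (hG : ContDiffAt ℝ 2 G (s₀, x₀))
    (hV : ∀ᶠ x in 𝓝 x₀, HasDerivAt (fun s => G (s, x)) (V x) s₀) :
    HasDerivAt (fun s => fderiv ℝ G (s, x₀) ∘L ContinuousLinearMap.inr ℝ ℝ E)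
      (fderiv ℝ V x₀) s₀ := by
  set D := fderiv ℝ (fderiv ℝ G) (s₀, x₀)
  have hD : HasFDerivAt (fderiv ℝ G) D (s₀, x₀) :=
    ((hG.fderiv_right (m := 1) (by norm_num)).differentiableAt one_ne_zero).hasFDerivAt
  have hsymm : ∀ a b, D a b = D b a := (hG.isSymmSndFDerivAt (by simp)).eq
  have hVeq : V =ᶠ[𝓝 x₀] fun x => fderiv ℝ G (s₀, x) (1, 0) := by
    have hd : ∀ᶠ p in 𝓝 (s₀, x₀), DifferentiableAt ℝ G p :=
      ((hG.of_le one_le_two).eventually (by simp)).mono fun p hp => hp.differentiableAt one_ne_zero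
    have hc : Tendsto (fun x => (s₀, x)) (𝓝 x₀) (𝓝 (s₀, x₀)) :=
      (Continuous.prodMk_right s₀).tendsto x₀
    filter_upwards [hV, hc.eventually hd] with x hx hdx
    exact hx.unique (hdx.hasFDerivAt.comp_hasDerivAt s₀
      ((hasDerivAt_id s₀).prodMk (hasDerivAt_const s₀ x)))
  have hV' : HasFDerivAt V
      ((ContinuousLinearMap.apply ℝ E ((1 : ℝ), (0 : E))) ∘L D ∘L
        ContinuousLinearMap.inr ℝ ℝ E) x₀ := by
    refine HasFDerivAt.congr_of_eventuallyEq ?_ hVeq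
    exact (ContinuousLinearMap.apply ℝ E ((1 : ℝ), (0 : E))).hasFDerivAt.comp x₀
      (hD.comp x₀ (hasFDerivAt_prodMk_right s₀ x₀))
  have h1 : HasDerivAt (fun s => fderiv ℝ G (s, x₀)) (D (1, 0)) s₀ :=
    hD.comp_hasDerivAt s₀ ((hasDerivAt_id s₀).prodMk (hasDerivAt_const s₀ x₀))
  have h2 := ((ContinuousLinearMap.compL ℝ E (ℝ × E) E).flip
    (ContinuousLinearMap.inr ℝ ℝ E)).hasFDerivAt.comp_hasDerivAt s₀ h1
  refine h2.congr_deriv ?_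
  rw [hV'.fderiv]
  ext w
  exact hsymm _ _

end MixedDerivative

/-! ### Densities in coordinates -/

namespace Density

variable {n : ℕ} {M : Type*} [TopologicalSpace M] [ChartedSpace (EuclideanSpace ℝ (Fin n)) M]
  {e e' : OpenPartialHomeomorph M (EuclideanSpace ℝ (Fin n))}

/-- The coordinate representation of a density in the chart `e`: the function `f` such that
`μ = f |dx₁ ∧ ⋯ ∧ dxₙ|`, as a function of the coordinates. -/
def coord (μ : Density n M) (e : OpenPartialHomeomorph M (EuclideanSpace ℝ (Fin n)))
    (x : EuclideanSpace ℝ (Fin n)) : ℝ :=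
  μ (e.symm x) (fun i => mfderiv (𝓡 n) (𝓡 n) e.symm x (EuclideanSpace.single i (1 : ℝ)))

theorem IsSmooth.contDiffOn_coord {μ : Density n M} (hμ : μ.IsSmooth)
    (he : e ∈ IsManifold.maximalAtlas (𝓡 n) ∞ M) : ContDiffOn ℝ ∞ (μ.coord e) e.target :=
  hμ e he

theorem coord_smul (f : M → ℝ) (μ : Density n M) (x : EuclideanSpace ℝ (Fin n)) :
    (f • μ).coord e x = f (e.symm x) * μ.coord e x := rfl

theorem pullback_smul (F : M → M) (f : M → ℝ) (μ : Density n M) :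
    (f • μ).pullback F = (f ∘ F) • μ.pullback F := rfl

/-- Tangent spaces at different points are the same type, so that a density can be evaluated on the
same tuple of vectors at two points; at equal points the values agree. -/
theorem apply_congr (μ : Density n M) {p q : M} (h : p = q)
    (w : Fin n → EuclideanSpace ℝ (Fin n)) :
    (μ p).toFun w = (μ q).toFun w := by
  subst h; rfl

/-- The transformation law of a density, for tuples given by their coordinates. -/
theorem apply_mfderiv_symm_comp (μ : Density n M) (x : EuclideanSpace ℝ (Fin n))
    (A : EuclideanSpace ℝ (Fin n) →L[ℝ] EuclideanSpace ℝ (Fin n)) :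
    μ (e.symm x) (fun i => mfderiv (𝓡 n) (𝓡 n) e.symm x (A (EuclideanSpace.single i (1 : ℝ)))) =
      |A.det| * μ.coord e x :=
  (VectorDensity.pullback rfl
    (mfderiv (𝓡 n) (𝓡 n) e.symm x).toLinearMap (μ (e.symm x))).map_comp' A.toLinearMap
      (fun i => EuclideanSpace.single i (1 : ℝ))

theorem pullback_pullback (μ : Density n M) {F G : M → M} (hF : MDifferentiable (𝓡 n) (𝓡 n) F)
    (hG : MDifferentiable (𝓡 n) (𝓡 n) G) : (μ.pullback F).pullback G = μ.pullback (F ∘ G) := by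
  funext p
  ext v
  change μ (F (G p)) _ = μ (F (G p)) _
  congr 1
  funext i
  exact (DFunLike.congr_fun (mfderiv_comp p (hF (G p)) (hG p)) (v i)).symm

theorem pullback_id (μ : Density n M) : μ.pullback (fun p => p) = μ := by
  funext p
  ext v
  change μ p _ = μ p _
  congr 1
  funext i
  exact DFunLike.congr_fun (mfderiv_id (I := 𝓡 n) (x := p)) (v i)

theorem mdifferentiableAt_of_mem_maximalAtlas (he : e ∈ IsManifold.maximalAtlas (𝓡 n) ∞ M)
    {p : M} (hp : p ∈ e.source) : MDifferentiableAt (𝓡 n) (𝓡 n) e p :=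
  ((contMDiffOn_of_mem_maximalAtlas he).contMDiffAt
    (e.open_source.mem_nhds hp)).mdifferentiableAt (by simp)

theorem mdifferentiableAt_symm_of_mem_maximalAtlas (he : e ∈ IsManifold.maximalAtlas (𝓡 n) ∞ M)
    {x : EuclideanSpace ℝ (Fin n)} (hx : x ∈ e.target) :
    MDifferentiableAt (𝓡 n) (𝓡 n) e.symm x :=
  ((contMDiffOn_symm_of_mem_maximalAtlas he).contMDiffAt
    (e.open_target.mem_nhds hx)).mdifferentiableAt (by simp)

theorem IsPositive.coord_pos {μ : Density n M} (hμ : μ.IsPositive)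
    (he : e ∈ IsManifold.maximalAtlas (𝓡 n) ∞ M) {x : EuclideanSpace ℝ (Fin n)}
    (hx : x ∈ e.target) : 0 < μ.coord e x := by
  refine hμ _ _ ?_
  have hinj : Function.Injective (mfderiv (𝓡 n) (𝓡 n) e.symm x) := by
    have h1 := mfderiv_comp x (mdifferentiableAt_of_mem_maximalAtlas he (e.map_target hx))
      (mdifferentiableAt_symm_of_mem_maximalAtlas he hx)
    have h2 : (e ∘ e.symm) =ᶠ[𝓝 x] id := by
      filter_upwards [e.open_target.mem_nhds hx] with y hy using e.right_inv hy
    rw [h2.mfderiv_eq, mfderiv_id] at h1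
    exact Function.LeftInverse.injective
      (g := mfderiv (𝓡 n) (𝓡 n) e (e.symm x)) fun w => (DFunLike.congr_fun h1 w).symm
  have hb := (EuclideanSpace.basisFun (Fin n) ℝ).toBasis.linearIndependent
  have := hb.map' (mfderiv (𝓡 n) (𝓡 n) e.symm x).toLinearMap (LinearMap.ker_eq_bot.2 hinj)
  convert! this using 1
  funext i
  have hi : (EuclideanSpace.basisFun (Fin n) ℝ).toBasis i = EuclideanSpace.single i (1 : ℝ) := by
    simp
  exact congrArg (mfderiv (𝓡 n) (𝓡 n) e.symm x) hi.symm

/-- The change of variables formula: in the charts `e` and `e'`, the pullback of a density along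
`F` is multiplication by the absolute value of the Jacobian determinant of `F`. -/
theorem coord_pullback (μ : Density n M) (he : e ∈ IsManifold.maximalAtlas (𝓡 n) ∞ M)
    (he' : e' ∈ IsManifold.maximalAtlas (𝓡 n) ∞ M) {F : M → M} {x : EuclideanSpace ℝ (Fin n)}
    (hx : x ∈ e.target) (hF : MDifferentiableAt (𝓡 n) (𝓡 n) F (e.symm x))
    (hFx : F (e.symm x) ∈ e'.source) :
    (μ.pullback F).coord e x =
      |(fderiv ℝ (fun y => e' (F (e.symm y))) x).det| * μ.coord e' (e' (F (e.symm x))) := by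
  set G := fun y => e' (F (e.symm y)) with hG
  have hsymm := mdifferentiableAt_symm_of_mem_maximalAtlas he hx
  have hFe : MDifferentiableAt (𝓡 n) (𝓡 n) (F ∘ e.symm) x := hF.comp x hsymm
  have hGd : MDifferentiableAt (𝓡 n) (𝓡 n) G x :=
    (mdifferentiableAt_of_mem_maximalAtlas he' hFx).comp x hFe
  have hGx : G x ∈ e'.target := e'.map_source hFx
  have hcomp := mfderiv_comp x (mdifferentiableAt_symm_of_mem_maximalAtlas he' hGx) hGd
  have heq : e'.symm ∘ G =ᶠ[𝓝 x] F ∘ e.symm := by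
    filter_upwards [hFe.continuousAt.preimage_mem_nhds (e'.open_source.mem_nhds hFx)] with y hy
    exact e'.left_inv hy
  rw [heq.mfderiv_eq, mfderiv_comp x hF hsymm, mfderiv_eq_fderiv] at hcomp
  rw [← apply_mfderiv_symm_comp]
  refine Eq.trans ?_ (μ.apply_congr (e'.left_inv hFx).symm _)
  change μ (F (e.symm x)) _ = μ (F (e.symm x)) _
  congr 1
  funext i
  exact DFunLike.congr_fun hcomp (EuclideanSpace.single i (1 : ℝ))

end Density

/-! ### Pullbacks of densities along families of maps -/

section Family

variable {n : ℕ} {M : Type*} [TopologicalSpace M] [ChartedSpace (EuclideanSpace ℝ (Fin n)) M]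
  {e e' : OpenPartialHomeomorph M (EuclideanSpace ℝ (Fin n))}
  {Θ : ℝ → M → M} {s₀ : ℝ} {x₀ : EuclideanSpace ℝ (Fin n)}

/-- The coordinate representation `(s, x) ↦ e' (Θ s (e⁻¹ x))` of a family of maps `Θ s : M → M`. -/
def familyInCharts (e e' : OpenPartialHomeomorph M (EuclideanSpace ℝ (Fin n))) (Θ : ℝ → M → M)
    (p : ℝ × EuclideanSpace ℝ (Fin n)) : EuclideanSpace ℝ (Fin n) :=
  e' (Θ p.1 (e.symm p.2))

theorem contDiffAt_familyInCharts (he : e ∈ IsManifold.maximalAtlas (𝓡 n) ∞ M)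
    (he' : e' ∈ IsManifold.maximalAtlas (𝓡 n) ∞ M) {k : ℕ∞ω} (hk : k ≤ ∞)
    (hΘ : ContMDiffAt (𝓘(ℝ, ℝ).prod (𝓡 n)) (𝓡 n) k (fun p : ℝ × M => Θ p.1 p.2) (s₀, e.symm x₀))
    (hx₀ : x₀ ∈ e.target) (hΘx : Θ s₀ (e.symm x₀) ∈ e'.source) :
    ContDiffAt ℝ k (familyInCharts e e' Θ) (s₀, x₀) := by
  rw [← contMDiffAt_iff_contDiffAt]
  have h1 : ContMDiffAt (𝓡 n) (𝓡 n) k e.symm x₀ :=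
    ((contMDiffOn_symm_of_mem_maximalAtlas he).contMDiffAt (e.open_target.mem_nhds hx₀)).of_le hk
  have h2 : ContMDiffAt (𝓡 n) (𝓡 n) k e' (Θ s₀ (e.symm x₀)) :=
    ((contMDiffOn_of_mem_maximalAtlas he').contMDiffAt (e'.open_source.mem_nhds hΘx)).of_le hk
  have h3 : ContMDiffAt 𝓘(ℝ, ℝ × EuclideanSpace ℝ (Fin n)) (𝓘(ℝ, ℝ).prod (𝓡 n)) k
      (fun p : ℝ × EuclideanSpace ℝ (Fin n) => (p.1, e.symm p.2)) (s₀, x₀) :=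
    contDiff_fst.contMDiff.contMDiffAt.prodMk
      (ContMDiffAt.comp (I' := 𝓡 n) (s₀, x₀) h1 contDiff_snd.contMDiff.contMDiffAt)
  exact ContMDiffAt.comp (I' := 𝓡 n) (s₀, x₀) h2
    (ContMDiffAt.comp (I' := 𝓘(ℝ, ℝ).prod (𝓡 n)) (s₀, x₀) hΘ h3)

namespace Density

variable [IsManifold (𝓡 n) ∞ M]

/-- The change of variables formula for a family of maps, near a point of `ℝ × M`. -/
theorem eventually_coord_pullback (μ : Density n M)
    (he : e ∈ IsManifold.maximalAtlas (𝓡 n) ∞ M) (he' : e' ∈ IsManifold.maximalAtlas (𝓡 n) ∞ M)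
    (hΘ : ContMDiffAt (𝓘(ℝ, ℝ).prod (𝓡 n)) (𝓡 n) 1 (fun p : ℝ × M => Θ p.1 p.2) (s₀, e.symm x₀))
    (hx₀ : x₀ ∈ e.target) (hΘx : Θ s₀ (e.symm x₀) ∈ e'.source) :
    ∀ᶠ p in 𝓝 (s₀, x₀), (μ.pullback (Θ p.1)).coord e p.2 =
      |(fderiv ℝ (familyInCharts e e' Θ) p ∘L
        ContinuousLinearMap.inr ℝ ℝ (EuclideanSpace ℝ (Fin n))).det| *
        μ.coord e' (familyInCharts e e' Θ p) := by
  have : IsManifold (𝓡 n) 1 M := .of_le (n := ∞) (by exact_mod_cast le_top)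
  have hG : ∀ᶠ p in 𝓝 (s₀, x₀), ContDiffAt ℝ 1 (familyInCharts e e' Θ) p :=
    (contDiffAt_familyInCharts he he' (by exact_mod_cast le_top) hΘ hx₀ hΘx).eventually (by simp)
  have hc : ContinuousAt (fun p : ℝ × EuclideanSpace ℝ (Fin n) => (p.1, e.symm p.2)) (s₀, x₀) :=
    continuousAt_fst.prodMk
      (ContinuousAt.comp (g := e.symm) (e.continuousAt_symm hx₀) continuousAt_snd)
  have hΘe := hc.eventually ((contMDiffAt_iff_contMDiffAt_nhds (by simp)).1 hΘ)
  have hsrc := (ContinuousAt.comp (g := fun p : ℝ × M => Θ p.1 p.2)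
    (f := fun p : ℝ × EuclideanSpace ℝ (Fin n) => (p.1, e.symm p.2)) (x := (s₀, x₀))
    hΘ.continuousAt hc).preimage_mem_nhds (e'.open_source.mem_nhds hΘx)
  have htgt : ∀ᶠ p in 𝓝 (s₀, x₀), p.2 ∈ e.target :=
    continuousAt_snd.eventually_mem (e.open_target.mem_nhds hx₀)
  filter_upwards [hG, hΘe, hsrc, htgt] with p hGp hΘp hsp htp
  have hF : ContMDiffAt (𝓡 n) (𝓡 n) 1 (Θ p.1) (e.symm p.2) :=
    ContMDiffAt.comp (I' := 𝓘(ℝ, ℝ).prod (𝓡 n)) (e.symm p.2)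
      (g := fun p : ℝ × M => Θ p.1 p.2) (f := fun x => (p.1, x)) hΘp
      (contMDiffAt_const.prodMk contMDiffAt_id)
  have hD : fderiv ℝ (fun y => e' (Θ p.1 (e.symm y))) p.2 =
      fderiv ℝ (familyInCharts e e' Θ) p ∘L
        ContinuousLinearMap.inr ℝ ℝ (EuclideanSpace ℝ (Fin n)) :=
    (HasFDerivAt.comp (g := familyInCharts e e' Θ) (f := fun y => (p.1, y)) p.2
      (hGp.differentiableAt one_ne_zero).hasFDerivAt (hasFDerivAt_prodMk_right p.1 p.2)).fderiv
  rw [← hD]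
  exact coord_pullback μ he he' htp (hF.mdifferentiableAt one_ne_zero) hsp

/-- The pullbacks of a smooth density along a smooth family of maps depend smoothly on the
parameter, near every point where the maps are invertible. -/
theorem IsSmooth.contDiffAt_coord_pullback {μ : Density n M} (hμ : μ.IsSmooth)
    (he : e ∈ IsManifold.maximalAtlas (𝓡 n) ∞ M) (he' : e' ∈ IsManifold.maximalAtlas (𝓡 n) ∞ M)
    (hΘ : ContMDiffAt (𝓘(ℝ, ℝ).prod (𝓡 n)) (𝓡 n) ∞ (fun p : ℝ × M => Θ p.1 p.2) (s₀, e.symm x₀))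
    (hx₀ : x₀ ∈ e.target) (hΘx : Θ s₀ (e.symm x₀) ∈ e'.source)
    (hdet : (fderiv ℝ (familyInCharts e e' Θ) (s₀, x₀) ∘L
        ContinuousLinearMap.inr ℝ ℝ (EuclideanSpace ℝ (Fin n))).det ≠ 0) :
    ContDiffAt ℝ ∞ (fun p => (μ.pullback (Θ p.1)).coord e p.2) (s₀, x₀) := by
  refine ContDiffAt.congr_of_eventuallyEq ?_ (μ.eventually_coord_pullback he he'
    (hΘ.of_le (by exact_mod_cast le_top)) hx₀ hΘx)
  have hG := contDiffAt_familyInCharts he he' le_rfl hΘ hx₀ hΘx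
  have h1 : ContDiffAt ℝ ∞ (fun p => fderiv ℝ (familyInCharts e e' Θ) p ∘L
      ContinuousLinearMap.inr ℝ ℝ (EuclideanSpace ℝ (Fin n))) (s₀, x₀) :=
    (hG.fderiv_right (m := ∞) (by simp)).clm_comp contDiffAt_const
  have h2 := (contDiffAt_abs hdet).comp (s₀, x₀)
    (contDiff_det_euclideanSpace.contDiffAt.comp (s₀, x₀) h1)
  have h3 := ((hμ.contDiffOn_coord he').contDiffAt
    (e'.open_target.mem_nhds (e'.map_source hΘx))).comp (s₀, x₀) hG
  exact h2.mul h3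

/-- The coordinate representation of the Lie derivative of a smooth `μ` along the vector field with
coordinate representation `V`, as the derivative at `(id, x)`, in the direction `(DV(x), V(x))`, of
the function `(A, y) ↦ |det A| f(y)`, where `μ = f |dx₁ ∧ ⋯ ∧ dxₙ|`. -/
def lieCoord (μ : Density n M) (e : OpenPartialHomeomorph M (EuclideanSpace ℝ (Fin n)))
    (V : EuclideanSpace ℝ (Fin n) → EuclideanSpace ℝ (Fin n)) (x : EuclideanSpace ℝ (Fin n)) : ℝ :=
  fderiv ℝ (fun p : (EuclideanSpace ℝ (Fin n) →L[ℝ] EuclideanSpace ℝ (Fin n)) ×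
    EuclideanSpace ℝ (Fin n) => |p.1.det| * μ.coord e p.2)
    (ContinuousLinearMap.id ℝ _, x) (fderiv ℝ V x, V x)

/-- The derivative at time `s₀` of the pullbacks of a density along a `C²` family of maps with
`Θ s₀ = id` depends only on the velocity `v` of the family at `s₀`. -/
theorem IsSmooth.hasDerivAt_coord_pullback {μ : Density n M} (hμ : μ.IsSmooth)
    (he : e ∈ IsManifold.maximalAtlas (𝓡 n) ∞ M)
    (hΘ : ContMDiffAt (𝓘(ℝ, ℝ).prod (𝓡 n)) (𝓡 n) 2 (fun p : ℝ × M => Θ p.1 p.2) (s₀, e.symm x₀))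
    (hx₀ : x₀ ∈ e.target) {v : ∀ p : M, TangentSpace (𝓡 n) p}
    (h0 : ∀ᶠ p in 𝓝 (e.symm x₀), Θ s₀ p = p ∧ HasMFDerivAt 𝓘(ℝ, ℝ) (𝓡 n) (fun s => Θ s p) s₀
      ((1 : ℝ →L[ℝ] ℝ).smulRight (v (Θ s₀ p)))) :
    HasDerivAt (fun s => (μ.pullback (Θ s)).coord e x₀)
      (μ.lieCoord e (fun x => mfderiv (𝓡 n) (𝓡 n) e (e.symm x) (v (e.symm x))) x₀) s₀ := by
  have hsrc : Θ s₀ (e.symm x₀) ∈ e.source := by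
    rw [h0.self_of_nhds.1]; exact e.map_target hx₀
  set G := familyInCharts e e Θ with hGdef
  have hG : ContDiffAt ℝ 2 G (s₀, x₀) :=
    contDiffAt_familyInCharts he he (WithTop.coe_le_coe.2 (le_top : (2 : ℕ∞) ≤ ⊤)) hΘ hx₀ hsrc
  let W : M → EuclideanSpace ℝ (Fin n) := fun p => mfderiv (𝓡 n) (𝓡 n) e p (v p)
  set V : EuclideanSpace ℝ (Fin n) → EuclideanSpace ℝ (Fin n) := fun x => W (e.symm x) with hV
  have hev : ∀ᶠ x in 𝓝 x₀, G (s₀, x) = x ∧ HasDerivAt (fun s => G (s, x)) (V x) s₀ := by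
    filter_upwards [(e.continuousAt_symm hx₀).eventually h0, e.open_target.mem_nhds hx₀]
      with x hx hxt
    have hxs : Θ s₀ (e.symm x) ∈ e.source := by rw [hx.1]; exact e.map_target hxt
    refine ⟨by simp only [hGdef, familyInCharts]; rw [hx.1, e.right_inv hxt], ?_⟩
    have h1 := HasMFDerivAt.comp s₀
      (mdifferentiableAt_of_mem_maximalAtlas he hxs).hasMFDerivAt hx.2
    have h2 : ∃ L : ℝ →L[ℝ] EuclideanSpace ℝ (Fin n), HasFDerivAt (fun s => G (s, x)) L s₀ ∧
        L 1 = W (Θ s₀ (e.symm x)) :=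
      ⟨_, h1.hasFDerivAt, congrArg (mfderiv (𝓡 n) (𝓡 n) e (Θ s₀ (e.symm x)))
        (one_smul ℝ (v (Θ s₀ (e.symm x))))⟩
    obtain ⟨L, hL, hL1⟩ := h2
    exact hL.hasDerivAt.congr_deriv (hL1.trans (congrArg W hx.1))
  have hA := hasDerivAt_fderiv_comp_inr hG (hev.mono fun x hx => hx.2)
  have hA0 : fderiv ℝ G (s₀, x₀) ∘L ContinuousLinearMap.inr ℝ ℝ (EuclideanSpace ℝ (Fin n)) =
      ContinuousLinearMap.id ℝ _ := by
    have h1 := (hG.differentiableAt two_ne_zero).hasFDerivAt.comp x₀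
      (hasFDerivAt_prodMk_right s₀ x₀)
    have h2 : (G ∘ fun x => (s₀, x)) =ᶠ[𝓝 x₀] id := hev.mono fun x hx => hx.1
    exact h1.unique ((hasFDerivAt_id x₀).congr_of_eventuallyEq h2)
  have hQ : DifferentiableAt ℝ (fun p : (EuclideanSpace ℝ (Fin n) →L[ℝ] EuclideanSpace ℝ (Fin n)) ×
      EuclideanSpace ℝ (Fin n) => |p.1.det| * μ.coord e p.2)
      (ContinuousLinearMap.id ℝ _, x₀) := by
    refine DifferentiableAt.mul ?_ ?_
    · refine DifferentiableAt.abs ?_ (by simp [ContinuousLinearMap.det])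
      have hdet := (contDiff_det_euclideanSpace (n := n) (k := 1)).differentiable one_ne_zero
      exact hdet.differentiableAt.comp _ differentiableAt_fst
    · exact DifferentiableAt.comp (g := μ.coord e) _ (((hμ.contDiffOn_coord he).contDiffAt
        (e.open_target.mem_nhds hx₀)).differentiableAt (by simp)) differentiableAt_snd
  have hpair := hA.prodMk hev.self_of_nhds.2
  have hfd := hQ.hasFDerivAt
  -- The coordinate formula is the function differentiated in `lieCoord`, along the curve
  -- `s ↦ (D_x G (s, x₀), G (s, x₀))`, which passes through `(id, x₀)` at `s = s₀`.
  have hpoint : (ContinuousLinearMap.id ℝ _, x₀) = (fderiv ℝ G (s₀, x₀) ∘L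
      ContinuousLinearMap.inr ℝ ℝ (EuclideanSpace ℝ (Fin n)), G (s₀, x₀)) :=
    Prod.ext hA0.symm hev.self_of_nhds.1.symm
  have hcomp := (hpoint ▸ hfd).comp_hasDerivAt s₀ hpair
  have hline : Tendsto (fun s : ℝ => (s, x₀)) (𝓝 s₀) (𝓝 (s₀, x₀)) :=
    (Continuous.prodMk_left x₀).tendsto s₀
  refine HasDerivAt.congr_of_eventuallyEq (hcomp.congr_deriv ?_)
    (hline.eventually (μ.eventually_coord_pullback he he (hΘ.of_le one_le_two) hx₀ hsrc))
  rw [← hpoint]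
  rfl

end Density

end Family

/-! ### The continuity equation -/

section ChainRule

variable {n : ℕ} {M : Type*} [TopologicalSpace M] [ChartedSpace (EuclideanSpace ℝ (Fin n)) M]
  {ρ : ℝ → M → ℝ}

/-- The chain rule along a curve `Γ` in `M` for a time-dependent function. -/
theorem hasDerivAt_apply_curve
    (hρ : ContMDiff ((𝓡 n).prod 𝓘(ℝ, ℝ)) 𝓘(ℝ, ℝ) ∞ (fun p : M × ℝ => ρ p.2 p.1))
    {Γ : ℝ → M} {t : ℝ} {w : TangentSpace (𝓡 n) (Γ t)}
    (hΓ : HasMFDerivAt 𝓘(ℝ, ℝ) (𝓡 n) Γ t ((1 : ℝ →L[ℝ] ℝ).smulRight w)) :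
    HasDerivAt (fun s => ρ s (Γ s))
      (tangentDeriv w (ρ t) + deriv (fun s => ρ s (Γ t)) t) t := by
  have hF : MDifferentiableAt ((𝓡 n).prod 𝓘(ℝ, ℝ)) 𝓘(ℝ, ℝ) (fun p : M × ℝ => ρ p.2 p.1)
      (Γ t, t) := hρ.contMDiffAt.mdifferentiableAt (by simp)
  have hcomp := HasMFDerivAt.comp t (g := fun p : M × ℝ => ρ p.2 p.1) (f := fun s => (Γ s, s))
    hF.hasMFDerivAt (hΓ.prodMk (hasMFDerivAt_id t))
  have h1 : ∃ L : ℝ →L[ℝ] ℝ, HasFDerivAt (fun s => ρ s (Γ s)) L t ∧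
      L 1 = mfderiv ((𝓡 n).prod 𝓘(ℝ, ℝ)) 𝓘(ℝ, ℝ) (fun p : M × ℝ => ρ p.2 p.1) (Γ t, t)
        ((w, (1 : ℝ)) : TangentSpace (𝓡 n) (Γ t) × ℝ) :=
    ⟨_, hcomp.hasFDerivAt, congrArg
      (mfderiv ((𝓡 n).prod 𝓘(ℝ, ℝ)) 𝓘(ℝ, ℝ) (fun p : M × ℝ => ρ p.2 p.1) (Γ t, t))
      (Prod.ext (one_smul ℝ w) rfl)⟩
  obtain ⟨L, hL, hL1⟩ := h1
  refine hL.hasDerivAt.congr_deriv (hL1.trans ((mfderiv_prod_eq_add_apply hF).trans ?_))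
  have h2 : mfderiv 𝓘(ℝ, ℝ) 𝓘(ℝ, ℝ) (fun s => ρ s (Γ t)) t = fderiv ℝ (fun s => ρ s (Γ t)) t :=
    mfderiv_eq_fderiv
  have h3 : fderiv ℝ (fun s => ρ s (Γ t)) t 1 = deriv (fun s => ρ s (Γ t)) t :=
    fderiv_apply_one_eq_deriv
  exact congrArg (tangentDeriv w (ρ t) + ·)
    ((congrArg (fun L : ℝ →L[ℝ] ℝ => L 1) h2).trans h3)

end ChainRule

section Continuity

variable {n : ℕ} {M : Type*} [TopologicalSpace M]
  [ChartedSpace (EuclideanSpace ℝ (Fin n)) M] [IsManifold (𝓡 n) ∞ M]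
  {e : OpenPartialHomeomorph M (EuclideanSpace ℝ (Fin n))}

/-- Local flows of smooth vector fields exist, so that `localFlow` is not its default value. -/
theorem localFlow_isLocalFlowAt {Y : ∀ p : M, TangentSpace (𝓡 n) p}
    (hY : ContMDiff (𝓡 n) (𝓡 n).tangent ∞ (fun p => (⟨p, Y p⟩ : TangentBundle (𝓡 n) M))) (q : M) :
    IsLocalFlowAt Y q (localFlow Y q) := by
  have h : ∃ θ, IsLocalFlowAt Y q θ := by
    obtain ⟨θ, -, hθ⟩ := hY.exists_contMDiffAt_localFlow one_ne_zero q
    exact ⟨θ, hθ⟩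
  rw [localFlow, dif_pos h]
  exact h.choose_spec

variable [T2Space M]

theorem Density.IsSmooth.coord_lieDerivative {μ : Density n M} (hμ : μ.IsSmooth)
    (he : e ∈ IsManifold.maximalAtlas (𝓡 n) ∞ M) {Y : ∀ p : M, TangentSpace (𝓡 n) p}
    (hY : ContMDiff (𝓡 n) (𝓡 n).tangent ∞ (fun p => (⟨p, Y p⟩ : TangentBundle (𝓡 n) M)))
    {x : EuclideanSpace ℝ (Fin n)} (hx : x ∈ e.target) :
    (lieDerivative Y μ).coord e x =
      μ.lieCoord e (fun y => mfderiv (𝓡 n) (𝓡 n) e (e.symm y) (Y (e.symm y))) x := by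
  obtain ⟨ε, hε, h⟩ := localFlow_isLocalFlowAt hY (e.symm x)
  refine (hμ.hasDerivAt_coord_pullback he
    (hY.contMDiffAt_zero_of_isMIntegralCurveOn 2 hε h) hx (h.mono fun p hp => ?_)).deriv
  exact ⟨hp.1, (hp.2 0 ⟨neg_lt_zero.2 hε, hε⟩).hasMFDerivAt (Ioo_mem_nhds (neg_lt_zero.2 hε) hε)⟩

variable {X : ℝ → ∀ p : M, TangentSpace (𝓡 n) p}

theorem contMDiff_timeDependentFlow_apply (hXs : IsSmoothTimeDependent X)
    (hX : IsCompleteTimeDependent X) (t₁ t₀ : ℝ) :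
    ContMDiff (𝓡 n) (𝓡 n) ∞ (timeDependentFlow hX t₁ t₀) :=
  ContMDiff.comp (I' := 𝓘(ℝ, ℝ).prod (𝓘(ℝ, ℝ).prod (𝓡 n)))
    (f := fun q : M => (t₁, t₀, q)) (contMDiff_timeDependentFlow hXs hX)
    (contMDiff_const.prodMk (contMDiff_const.prodMk contMDiff_id))

/-- Pullback along the cocycle property `φ^{t₂,t₁} ∘ φ^{t₁,t₀} = φ^{t₂,t₀}`. -/
theorem Density.pullback_timeDependentFlow_comp (hXs : IsSmoothTimeDependent X)
    (hX : IsCompleteTimeDependent X) (μ : Density n M) (t₂ t₁ t₀ : ℝ) :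
    (μ.pullback (timeDependentFlow hX t₂ t₁)).pullback (timeDependentFlow hX t₁ t₀) =
      μ.pullback (timeDependentFlow hX t₂ t₀) := by
  rw [Density.pullback_pullback μ
    ((contMDiff_timeDependentFlow_apply hXs hX _ _).mdifferentiable (by simp))
    ((contMDiff_timeDependentFlow_apply hXs hX _ _).mdifferentiable (by simp))]
  congr 1
  exact funext fun q => timeDependentFlow_comp hXs hX t₂ t₁ t₀ q

variable {μ : Density n M} {ρ₀ : M → ℝ} {ρ : ℝ → M → ℝ}

/-- The transported function `ρ` is smooth: in charts it is the quotient of the transported density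
by the positive smooth density `μ`, and the Jacobian determinant of the flow does not vanish. -/
theorem contMDiff_of_smul_eq_pullback_timeDependentFlow (hXs : IsSmoothTimeDependent X)
    (hX : IsCompleteTimeDependent X) (hμ : μ.IsSmooth) (hμpos : μ.IsPositive)
    (hρ₀ : ContMDiff (𝓡 n) 𝓘(ℝ, ℝ) ∞ ρ₀)
    (hρ : ∀ t, ρ t • μ = (ρ₀ • μ).pullback (timeDependentFlow hX 0 t)) :
    ContMDiff ((𝓡 n).prod 𝓘(ℝ, ℝ)) 𝓘(ℝ, ℝ) ∞ (fun p : M × ℝ => ρ p.2 p.1) := by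
  rintro ⟨q₀, t₀⟩
  set Θ : ℝ → M → M := fun t => timeDependentFlow hX 0 t with hΘdef
  have hΘ : ContMDiff (𝓘(ℝ, ℝ).prod (𝓡 n)) (𝓡 n) ∞ (fun p : ℝ × M => Θ p.1 p.2) :=
    ContMDiff.comp (I' := 𝓘(ℝ, ℝ).prod (𝓘(ℝ, ℝ).prod (𝓡 n)))
      (f := fun p : ℝ × M => ((0 : ℝ), p)) (contMDiff_timeDependentFlow hXs hX)
      (contMDiff_const.prodMk contMDiff_id)
  set e := chartAt (EuclideanSpace ℝ (Fin n)) q₀ with hedef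
  have he : e ∈ IsManifold.maximalAtlas (𝓡 n) ∞ M := IsManifold.chart_mem_maximalAtlas q₀
  have hq₀ : q₀ ∈ e.source := mem_chart_source _ q₀
  have hx₀ : e q₀ ∈ e.target := e.map_source hq₀
  set e' := chartAt (EuclideanSpace ℝ (Fin n)) (Θ t₀ (e.symm (e q₀))) with hedef'
  have he' : e' ∈ IsManifold.maximalAtlas (𝓡 n) ∞ M := IsManifold.chart_mem_maximalAtlas _
  have hΘx : Θ t₀ (e.symm (e q₀)) ∈ e'.source := mem_chart_source _ _
  have hdet : (fderiv ℝ (familyInCharts e e' Θ) (t₀, e q₀) ∘L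
      ContinuousLinearMap.inr ℝ ℝ (EuclideanSpace ℝ (Fin n))).det ≠ 0 := by
    -- Pulling back by `φ^{t₀,0}` and then by `φ^{0,t₀}` gives back `μ`, which does not vanish.
    intro h0
    have h1 := ((μ.pullback (timeDependentFlow hX t₀ 0)).eventually_coord_pullback he he'
      (hΘ.contMDiffAt.of_le (by exact_mod_cast le_top)) hx₀ hΘx).self_of_nhds
    rw [h0, abs_zero, zero_mul, hΘdef] at h1
    simp only at h1
    rw [Density.pullback_timeDependentFlow_comp hXs hX,
      show timeDependentFlow hX t₀ t₀ = fun q => q from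
        funext fun q => timeDependentFlow_self hX t₀ q, Density.pullback_id] at h1
    exact (hμpos.coord_pos he hx₀).ne' h1
  -- In the chart `e`, the equation `ρ t • μ = (φ^{0,t})^* (ρ₀ • μ)` determines `ρ`.
  have hR : ContDiffAt ℝ ∞ (fun p : ℝ × EuclideanSpace ℝ (Fin n) =>
      ρ₀ (Θ p.1 (e.symm p.2)) * (μ.pullback (Θ p.1)).coord e p.2 / μ.coord e p.2)
      (t₀, e q₀) := by
    have h1 := hμ.contDiffAt_coord_pullback he he' hΘ.contMDiffAt hx₀ hΘx hdet
    have h2 : ContDiffAt ℝ ∞ (fun p : ℝ × EuclideanSpace ℝ (Fin n) => μ.coord e p.2)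
        (t₀, e q₀) :=
      ((hμ.contDiffOn_coord he).contDiffAt (e.open_target.mem_nhds hx₀)).comp (t₀, e q₀)
        contDiffAt_snd
    have h3 : ContDiffAt ℝ ∞ (fun p : ℝ × EuclideanSpace ℝ (Fin n) =>
        ρ₀ (Θ p.1 (e.symm p.2))) (t₀, e q₀) := by
      rw [← contMDiffAt_iff_contDiffAt]
      have h4 : ContMDiffAt (𝓡 n) (𝓡 n) ∞ e.symm (e q₀) :=
        (contMDiffOn_symm_of_mem_maximalAtlas he).contMDiffAt (e.open_target.mem_nhds hx₀)
      have h5 : ContMDiffAt 𝓘(ℝ, ℝ × EuclideanSpace ℝ (Fin n)) (𝓘(ℝ, ℝ).prod (𝓡 n)) ∞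
          (fun p : ℝ × EuclideanSpace ℝ (Fin n) => (p.1, e.symm p.2)) (t₀, e q₀) :=
        contDiff_fst.contMDiff.contMDiffAt.prodMk
          (ContMDiffAt.comp (I' := 𝓡 n) (t₀, e q₀) h4 contDiff_snd.contMDiff.contMDiffAt)
      exact ContMDiffAt.comp (I' := 𝓘(ℝ, ℝ).prod (𝓡 n)) (t₀, e q₀)
        (g := fun p : ℝ × M => ρ₀ (Θ p.1 p.2)) (hρ₀.comp hΘ).contMDiffAt h5
    exact (h3.mul h1).div h2 (hμpos.coord_pos he hx₀).ne'
  have hchart : ContMDiffAt ((𝓡 n).prod 𝓘(ℝ, ℝ)) 𝓘(ℝ, ℝ × EuclideanSpace ℝ (Fin n)) ∞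
      (fun p : M × ℝ => (p.2, e p.1)) (q₀, t₀) :=
    contMDiffAt_snd.prodMk_space (ContMDiffAt.comp (I' := 𝓡 n) (q₀, t₀)
      ((contMDiffOn_of_mem_maximalAtlas he).contMDiffAt (e.open_source.mem_nhds hq₀))
      contMDiffAt_fst)
  refine (ContMDiffAt.comp (I' := 𝓘(ℝ, ℝ × EuclideanSpace ℝ (Fin n))) (q₀, t₀)
    hR.contMDiffAt hchart).congr_of_eventuallyEq ?_
  have hsrc : ∀ᶠ p in 𝓝 (q₀, t₀), p.1 ∈ e.source :=
    continuousAt_fst.eventually_mem (e.open_source.mem_nhds hq₀)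
  filter_upwards [hsrc] with p hp
  have h1 := congrArg (fun ν : Density n M => ν.coord e (e p.1)) (hρ p.2)
  simp only [Density.pullback_smul, Density.coord_smul, e.left_inv hp, Function.comp_apply] at h1
  change ρ p.2 p.1 = ρ₀ (Θ p.2 (e.symm (e p.1))) * (μ.pullback (Θ p.2)).coord e (e p.1) /
    μ.coord e (e p.1)
  rw [e.left_inv hp, eq_div_iff (hμpos.coord_pos he (e.map_source hp)).ne', h1]

end Continuity

end

theorem mainTheorem2 {n : ℕ} {M : Type*} [TopologicalSpace M] [T2Space M]
    [ChartedSpace (EuclideanSpace ℝ (Fin n)) M] [IsManifold (𝓡 n) ∞ M]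
    (X : ℝ → ∀ p : M, TangentSpace (𝓡 n) p)
    (hXsmooth : IsSmoothTimeDependent X) (hX : IsCompleteTimeDependent X)
    (μ : Density n M) (hμsmooth : μ.IsSmooth) (hμpos : μ.IsPositive)
    (ρ₀ : M → ℝ) (hρ₀ : ContMDiff (𝓡 n) 𝓘(ℝ, ℝ) ∞ ρ₀) :
    (∃! ρ : ℝ → M → ℝ, ∀ t : ℝ, ρ t • μ = (ρ₀ • μ).pullback (timeDependentFlow hX 0 t)) ∧
    ∀ ρ : ℝ → M → ℝ,
      (∀ t : ℝ, ρ t • μ = (ρ₀ • μ).pullback (timeDependentFlow hX 0 t)) →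
      ContMDiff ((𝓡 n).prod 𝓘(ℝ, ℝ)) 𝓘(ℝ, ℝ) ∞ (fun p : M × ℝ => ρ p.2 p.1) ∧
      ∀ (t : ℝ) (q : M),
        tangentDeriv (X t q) (ρ t) + ρ t q * divergence μ (X t) q
          = - deriv (fun s : ℝ => ρ s q) t := by
  refine ⟨⟨fun t => ((ρ₀ • μ).pullback (timeDependentFlow hX 0 t)).ratio μ,
    fun t => Density.ratio_smul hμpos _, fun ρ' h => funext fun t =>
      Density.smul_left_injective hμpos ((h t).trans (Density.ratio_smul hμpos _).symm)⟩,
    fun ρ hρ => ?_⟩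
  have hsmooth := contMDiff_of_smul_eq_pullback_timeDependentFlow hXsmooth hX hμsmooth hμpos hρ₀ hρ
  refine ⟨hsmooth, fun t q => ?_⟩
  set e := chartAt (EuclideanSpace ℝ (Fin n)) q
  have he : e ∈ IsManifold.maximalAtlas (𝓡 n) ∞ M := IsManifold.chart_mem_maximalAtlas q
  have hq : q ∈ e.source := mem_chart_source _ q
  have hx : e q ∈ e.target := e.map_source hq
  have heq : e.symm (e q) = q := e.left_inv hq
  set Θ : ℝ → M → M := fun s => timeDependentFlow hX s t with hΘ
  -- Transport of `ρ s • μ` back to time `t` is independent of `s`.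
  have hconst : ∀ s, ρ s (Θ s q) * (μ.pullback (Θ s)).coord e (e q) = ρ t q * μ.coord e (e q) := by
    intro s
    have h1 : (ρ s • μ).pullback (Θ s) = ρ t • μ := by
      rw [hρ s, Density.pullback_timeDependentFlow_comp hXsmooth hX, hρ t]
    have h2 := congrArg (fun ν : Density n M => ν.coord e (e q)) h1
    simpa only [Density.pullback_smul, Density.coord_smul, heq, Function.comp_apply] using h2
  have hΘt : ∀ p, Θ t p = p := fun p => timeDependentFlow_self hX t p
  have hcurve : ∀ p, HasMFDerivAt 𝓘(ℝ, ℝ) (𝓡 n) (fun s => Θ s p) t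
      ((1 : ℝ →L[ℝ] ℝ).smulRight (X t (Θ t p))) := fun p =>
    timeDependentFlow_isIntegralCurve hX t p t
  have hΘs : ContMDiff (𝓘(ℝ, ℝ).prod (𝓡 n)) (𝓡 n) ∞ (fun p : ℝ × M => Θ p.1 p.2) :=
    ContMDiff.comp (I' := 𝓘(ℝ, ℝ).prod (𝓘(ℝ, ℝ).prod (𝓡 n)))
      (f := fun p : ℝ × M => (p.1, t, p.2)) (contMDiff_timeDependentFlow hXsmooth hX)
      (contMDiff_fst.prodMk (contMDiff_const.prodMk contMDiff_snd))
  -- Both `φ^{s,t}` and the local flow of `X t` have velocity `X t`, so they give the same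
  -- derivative of the pullback of `μ`, which is the Lie derivative.
  have hD : HasDerivAt (fun s => (μ.pullback (Θ s)).coord e (e q))
      (divergence μ (X t) q * μ.coord e (e q)) t := by
    have h1 := hμsmooth.hasDerivAt_coord_pullback he
      (hΘs.contMDiffAt.of_le (WithTop.coe_le_coe.2 (le_top : (2 : ℕ∞) ≤ ⊤))) hx
      (Filter.Eventually.of_forall fun p => ⟨hΘt p, hcurve p⟩)
    refine h1.congr_deriv ?_
    rw [← hμsmooth.coord_lieDerivative he (hXsmooth.contMDiff_apply t) hx,
      ← divergence_smul hμpos, Density.coord_smul, heq]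
  have hh := hasDerivAt_apply_curve hsmooth (hcurve q)
  have hprod := hh.mul hD
  have hzero : HasDerivAt (fun s => ρ s (Θ s q) * (μ.pullback (Θ s)).coord e (e q)) 0 t := by
    rw [funext hconst]
    exact hasDerivAt_const t _
  have key := hprod.unique hzero
  have hid : μ.pullback (Θ t) = μ := by
    rw [show Θ t = fun p => p from funext hΘt, Density.pullback_id]
  have htan : tangentDeriv (X t (Θ t q)) (ρ t) = tangentDeriv (X t q) (ρ t) :=
    congrArg (fun p => tangentDeriv (X t p) (ρ t)) (hΘt q)
  rw [hid, htan, hΘt q] at key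
  have hpos := hμpos.coord_pos he hx
  have : (tangentDeriv (X t q) (ρ t) + deriv (fun s => ρ s q) t +
      ρ t q * divergence μ (X t) q) * μ.coord e (e q) = 0 := by
    rw [← key]; ring
  linarith [(mul_eq_zero.1 this).resolve_right hpos.ne']
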